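/- Let $\Bbbk$ be an algebraically closed field of characteristic $0$ and $D=\Bbbk[x]/(x^2)$. Let $\mathscr D$ be the 2-category with one object $\mathtt i$ (identified with the category $D\text{-mod}$ of finite dimensional $D$-modules), whose 1-morphisms are the endofunctors of $D\text{-mod}$ isomorphic to $U\otimes_D-$ for a finite dimensional $D$-$D$-bimodule $U$, and whose 2-morphisms are all natural transformations; $\mathbb 1$ denotes the identity 1-morphism. For $k\ge 1$ let $W_k$ be the bimodule with basis $w_1,\dots,w_{2k+1}$ in which $xw_{2i-1}=w_{2i}$ and $w_{2i+1}x=w_{2i}$ for $1\le i\le k$, all other products of $x$ with basis vectors being $0$. Let $M_k$ be the bimodule with basis $m_1,\dots,m_{2k+3}$ in which $m_{2i}x=m_{2i-1}$ and $xm_{2i}=m_{2i+1}$ for $1\le i\le k+1$, all other products being $0$; put $N_k=M_k/\langle m_{2k+3}\rangle$ and $S_k=M_k/\langle m_1\rangle$. We use the same letters for the corresponding 1-morphisms. Let $\psi_k:\mathbb 1\to W_k$ be the 2-morphism given by the bimodule homomorphism $D\to W_k$ with $1\mapsto w_1+w_3+\dots+w_{2k+1}$ and $x\mapsto w_2+w_4+\dots+w_{2k}$.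 For indecomposable 1-morphisms of a 2-category, write $F\le_L G$ (respectively $F\le_J G$) if $G$ is a direct summand of $H\circ F$ (respectively of $H_1\circ F\circ H_2$) for some 1-morphisms $H$ (respectively $H_1,H_2$); left cells and two-sided cells are the classes of the associated equivalence relations on isomorphism classes of indecomposable 1-morphisms. Let $\mathcal J_m=\{W_m,S_m,N_m,M_m\}$, a two-sided cell of $\mathscr D$, and let $\mathscr D^{(m)}$ be the 2-full 2-subcategory of $\mathscr D$ given by the additive closure of $\mathbb 1$ and all 1-morphisms in two-sided cells $\mathcal J\ge_J\mathcal J_m$. A 1-morphism $H$ is co-good for a left cell $\mathcal L$ via $\psi:\mathbb 1\to H$ if $F\psi:F\to F\circ H$ is left split (has a left inverse) for every $F\in\mathcal L$. It is co-great for $\mathcal L$ if it is co-good via some $\psi$ such that, whenever $H'$ is co-good for $\mathcal L$ via $\psi':\mathbb 1\to H'$, there is a 2-morphism $\gamma:H'\to H$ with $\psi=\gamma\circ\psi'$. **Proposition.** Let $m\ge k\ge 1$. Then $\mathcal L=\{W_k,S_k\}$ (up to isomorphism) is a left cell of $\mathscr D^{(m)}$, and the 1-morphism $W_k$ of $\mathscr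 D^{(m)}$ is co-great for $\mathcal L$, with witness $\psi_k$: the 2-morphisms $W_k\psi_k$ and $S_k\psi_k$ are left split, and for every 1-morphism $H'$ of $\mathscr D^{(m)}$ which is co-good for $\mathcal L$ via a 2-morphism $\psi':\mathbb 1\to H'$ there is a 2-morphism $\gamma:H'\to W_k$ with $\psi_k=\gamma\circ\psi'$. -/

import Mathlib

open CategoryTheory Limits TensorProduct

universe u

namespace DualBimod

/-- The category of finite dimensional modules over the dual numbers `D = K[x]/(x²)`;
Mathlib writes `K[ε]`, so `ε` below is the generator `x`. -/
abbrev DMod (K : Type u) [Field K] := FGModuleCat.{u} (DualNumber K)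

/-- Endofunctors of `D`-mod. The composition `F ∘ G` is written `G ⋙ F`, and `𝟭 _` is the
identity 1-morphism. -/
abbrev EndoD (K : Type u) [Field K] := DMod K ⥤ DMod K

noncomputable instance (K : Type u) [Field K] : HasFiniteBiproducts (EndoD K) :=
  HasFiniteBiproducts.of_hasFiniteProducts

/-- A finite dimensional `D`-`D`-bimodule, with `K` acting centrally. Since `D` is commutative, the
right action is recorded as a `D`-module structure on `carrier`. The left action is a `K`-algebra
homomorphism to the endomorphisms that commute with the right action. -/
structure Bimodule (K : Type u) [Field K] where
  carrier : Type u
  [addCommGroup : AddCommGroup carrier]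
  [moduleBase : Module K carrier]
  [moduleRight : Module (DualNumber K) carrier]
  [tower : IsScalarTower K (DualNumber K) carrier]
  [finite : Module.Finite K carrier]
  left : DualNumber K →ₐ[K] Module.End (DualNumber K) carrier

namespace Bimodule

attribute [instance] addCommGroup moduleBase moduleRight tower finite

variable {K : Type u} [Field K]

/-- The left `D`-module `U ⊗_D X`, where the tensor product is formed with respect to the right
action on `U` and `D` acts by the left action on `U`. -/
def Tensor (U : Bimodule K) (X : Type u) [AddCommGroup X] [Module (DualNumber K) X] : Type u :=
  U.carrier ⊗[DualNumber K] X

section Tensor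

variable (U : Bimodule K) (X : Type u) [AddCommGroup X] [Module (DualNumber K) X]

noncomputable instance : AddCommGroup (U.Tensor X) :=
  inferInstanceAs (AddCommGroup (U.carrier ⊗[DualNumber K] X))

noncomputable instance : Module (DualNumber K) (U.Tensor X) :=
  Module.compHom (U.carrier ⊗[DualNumber K] X)
    ((Module.End.rTensorAlgHom (DualNumber K) U.carrier X).toRingHom.comp U.left.toRingHom)

variable {X}

/-- The pure tensor `u ⊗ y` in `U ⊗_D X`. -/
noncomputable def pure (u : U.carrier) (y : X) : U.Tensor X := u ⊗ₜ[DualNumber K] y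

theorem smul_pure (d : DualNumber K) (u : U.carrier) (y : X) :
    d • U.pure u y = U.pure (U.left d u) y := rfl

theorem pure_smul (d : DualNumber K) (u : U.carrier) (y : X) :
    U.pure u (d • y) = U.pure (d • u) y := (TensorProduct.smul_tmul d u y).symm

theorem add_pure (a b : U.carrier) (y : X) : U.pure (a + b) y = U.pure a y + U.pure b y :=
  TensorProduct.add_tmul a b y

theorem pure_add (a : U.carrier) (y z : X) : U.pure a (y + z) = U.pure a y + U.pure a z :=
  TensorProduct.tmul_add a y z

theorem zero_pure (y : X) : U.pure 0 y = 0 := TensorProduct.zero_tmul U.carrier y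

theorem pure_zero (u : U.carrier) : U.pure u (0 : X) = 0 := TensorProduct.tmul_zero X u

theorem left_base (c : K) (u : U.carrier) : U.left (algebraMap K _ c) u = c • u := by
  rw [AlgHom.commutes]; rfl

theorem span_pure_induction (S : Submodule (DualNumber K) (U.Tensor X))
    (h : ∀ u y, U.pure u y ∈ S) : S = ⊤ := by
  rw [eq_top_iff]
  rintro t -
  induction t using TensorProduct.induction_on with
  | zero => exact S.zero_mem
  | tmul u y => exact h u y
  | add a b ha hb => exact S.add_mem ha hb

instance [Module.Finite (DualNumber K) X] : Module.Finite (DualNumber K) (U.Tensor X) := by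
  obtain ⟨su, hsu⟩ := (inferInstance : Module.Finite K U.carrier).fg_top
  obtain ⟨sx, hsx⟩ := (inferInstance : Module.Finite (DualNumber K) X).fg_top
  classical
  refine ⟨⟨(su ×ˢ sx).image fun p => U.pure p.1 p.2, ?_⟩⟩
  apply span_pure_induction
  intro u y
  have hy : y ∈ Submodule.span (DualNumber K) (sx : Set X) := hsx ▸ Submodule.mem_top
  induction hy using Submodule.span_induction generalizing u with
  | mem y hy =>
    have hu : u ∈ Submodule.span K (su : Set U.carrier) := hsu ▸ Submodule.mem_top
    induction hu using Submodule.span_induction with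
    | mem u hu =>
      exact Submodule.subset_span (by
        simp only [Finset.coe_image, Set.mem_image, Finset.mem_coe, Finset.mem_product]
        exact ⟨(u, y), ⟨hu, hy⟩, rfl⟩)
    | zero => rw [zero_pure]; exact Submodule.zero_mem _
    | add a b _ _ ha hb => rw [add_pure]; exact Submodule.add_mem _ ha hb
    | smul c a _ ha =>
      rw [← left_base, ← smul_pure]
      exact Submodule.smul_mem _ _ ha
  | zero => rw [pure_zero]; exact Submodule.zero_mem _
  | add a b _ _ ha hb => rw [pure_add]; exact Submodule.add_mem _ (ha u) (hb u)
  | smul d a _ ha => rw [pure_smul]; exact ha _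

/-- The map `U ⊗_D f`. -/
noncomputable def tensorMap {Y : Type u} [AddCommGroup Y] [Module (DualNumber K) Y]
    (f : X →ₗ[DualNumber K] Y) : U.Tensor X →ₗ[DualNumber K] U.Tensor Y where
  toFun := LinearMap.lTensor U.carrier f
  map_add' := map_add (LinearMap.lTensor U.carrier f)
  map_smul' d t := LinearMap.congr_fun
    ((LinearMap.lTensor_comp_rTensor (M := U.carrier) (f := U.left d) (g := f)).trans
      (LinearMap.rTensor_comp_lTensor (M := U.carrier) (f := U.left d) (g := f)).symm) t

theorem tensorMap_pure {Y : Type u} [AddCommGroup Y] [Module (DualNumber K) Y]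
    (f : X →ₗ[DualNumber K] Y) (u : U.carrier) (y : X) :
    U.tensorMap f (U.pure u y) = U.pure u (f y) := rfl

end Tensor

/-- The endofunctor `U ⊗_D -` of `D`-mod. -/
noncomputable def tensorFunctor (U : Bimodule K) : EndoD K where
  obj X := FGModuleCat.of (DualNumber K) (U.Tensor X)
  map f := FGModuleCat.ofHom (U.tensorMap f.hom.hom)
  map_id X := by
    ext t
    exact LinearMap.congr_fun (LinearMap.lTensor_id U.carrier X) t
  map_comp {X Y Z} f g := by
    ext t
    exact LinearMap.congr_fun (LinearMap.lTensor_comp U.carrier g.hom.hom f.hom.hom) t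

/-- The 2-morphism `𝟙 ⟶ U ⊗_D -` given by the bimodule homomorphism `D → U` that sends `1` to `v`,
where `v` is an element on which the left and right actions agree. Its component at `X` is
`y ↦ v ⊗ y`. -/
noncomputable def ofCentral (U : Bimodule K) (v : U.carrier) (hv : ∀ d, U.left d v = d • v) :
    𝟭 (DMod K) ⟶ U.tensorFunctor where
  app X := FGModuleCat.ofHom
    { toFun := fun y : X => U.pure v y
      map_add' := fun y z => TensorProduct.tmul_add v y z
      map_smul' := fun d y => by
        rw [pure_smul, RingHom.id_apply, smul_pure, hv] }
  naturality _ _ _ := rfl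

/-- The bimodule given by a vector space `V` with commuting square-zero operators `l` (left
multiplication by `x`) and `r` (right multiplication by `x`). -/
noncomputable def ofOperators (V : Type u) [AddCommGroup V] [Module K V] [Module.Finite K V]
    (l r : Module.End K V) (hl : l * l = 0) (hr : r * r = 0) (hlr : l * r = r * l) :
    Bimodule K :=
  let ρ : DualNumber K →ₐ[K] Module.End K V :=
    DualNumber.lift ⟨(Algebra.ofId K _, r), hr, fun a => (Algebra.commutes a r).symm⟩
  letI : Module (DualNumber K) V := Module.compHom V ρ.toRingHom
  haveI : IsScalarTower K (DualNumber K) V :=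
    ⟨fun c d v => by
      change ρ (c • d) v = c • ρ d v
      rw [map_smul]; rfl⟩
  let L : Module.End (DualNumber K) V :=
    { toFun := l
      map_add' := map_add l
      map_smul' := fun d v => by
        change l (ρ d v) = ρ d (l v)
        have h : ρ d = algebraMap K _ d.fst + algebraMap K _ d.snd * r :=
          DualNumber.lift_apply_apply _ d
        have h' : l (r v) = r (l v) := LinearMap.congr_fun hlr v
        rw [h]
        simp [h'] }
  { carrier := V
    left := DualNumber.lift ⟨(Algebra.ofId K _, L),
      LinearMap.ext fun v => LinearMap.congr_fun hl v, fun a => (Algebra.commutes a L).symm⟩ }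

theorem ofOperators_central {V : Type u} [AddCommGroup V] [Module K V] [Module.Finite K V]
    {l r : Module.End K V} {hl : l * l = 0} {hr : r * r = 0} {hlr : l * r = r * l}
    (v : (ofOperators V l r hl hr hlr).carrier) (hv : l v = r v) (d : DualNumber K) :
    (ofOperators V l r hl hr hlr).left d v = d • v := by
  have h1 : (ofOperators V l r hl hr hlr).left d v =
    algebraMap K (Module.End K V) d.fst v + algebraMap K (Module.End K V) d.snd (l v) := rfl
  have h2 : d • v =
    algebraMap K (Module.End K V) d.fst v + algebraMap K (Module.End K V) d.snd (r v) := rfl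
  rw [h1, h2, hv]

end Bimodule

section Strings

variable (K : Type u) [Field K]

/-- Left multiplication by `x` on the string with basis `e 0, …, e (n-1)`. The basis vectors `e j`
with `j + p` even are at the top, those with `j + p` odd at the bottom. A top vector satisfies
`x · e i = e (i+1)` (zero if `i + 1 = n`), and the bottom vectors are annihilated. -/
def leftX (p n : ℕ) : Module.End K (Fin n → K) where
  toFun v j := if Odd (j.1 + p) ∧ 0 < j.1 then v ⟨j.1 - 1, by omega⟩ else 0
  map_add' v w := by ext j; simp only [Pi.add_apply]; split_ifs <;> simp
  map_smul' c v := by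
    ext j; simp only [Pi.smul_apply, RingHom.id_apply]; split_ifs <;> simp

/-- Right multiplication by `x` on the same string: `e i · x = e (i-1)` for a top vector (zero if
`i = 0`), and the bottom vectors are annihilated. -/
def rightX (p n : ℕ) : Module.End K (Fin n → K) where
  toFun v j := if h : Odd (j.1 + p) ∧ j.1 + 1 < n then v ⟨j.1 + 1, h.2⟩ else 0
  map_add' v w := by ext j; simp only [Pi.add_apply]; split_ifs <;> simp
  map_smul' c v := by
    ext j; simp only [Pi.smul_apply, RingHom.id_apply]; split_ifs <;> simp

theorem leftX_sq (p n : ℕ) : leftX K p n * leftX K p n = 0 := by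
  refine LinearMap.ext fun v => funext fun j => ?_
  simp only [leftX, Module.End.mul_apply, LinearMap.coe_mk, AddHom.coe_mk]
  split_ifs with h h' <;> first | rfl | skip
  exact absurd h'.1 (by have := h.1; grind)

theorem rightX_sq (p n : ℕ) : rightX K p n * rightX K p n = 0 := by
  refine LinearMap.ext fun v => funext fun j => ?_
  simp only [rightX, Module.End.mul_apply, LinearMap.coe_mk, AddHom.coe_mk]
  split_ifs with h h' <;> first | rfl | skip
  exact absurd h'.1 (by have := h.1; grind)

theorem leftX_mul_rightX (p n : ℕ) :
    leftX K p n * rightX K p n = rightX K p n * leftX K p n := by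
  refine LinearMap.ext fun v => funext fun j => ?_
  simp only [leftX, rightX, Module.End.mul_apply, LinearMap.coe_mk, AddHom.coe_mk]
  split_ifs <;> first | rfl | grind

/-- The string bimodule with basis `e 0, …, e (n-1)` which starts at a top vector if `p = 0` and
at a bottom vector if `p = 1`. -/
noncomputable def stringBimodule (p n : ℕ) : Bimodule K :=
  Bimodule.ofOperators (Fin n → K) (leftX K p n) (rightX K p n)
    (leftX_sq K p n) (rightX_sq K p n) (leftX_mul_rightX K p n)

/-- `W_k`, with `w_i` the basis vector `e (i-1)`, `1 ≤ i ≤ 2k+1`. -/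
noncomputable def bimodW (k : ℕ) : Bimodule K := stringBimodule K 0 (2 * k + 1)

/-- `S_k`, with `m_i` the basis vector `e (i-2)`, `2 ≤ i ≤ 2k+3`. -/
noncomputable def bimodS (k : ℕ) : Bimodule K := stringBimodule K 0 (2 * k + 2)

/-- `N_k`, with `m_i` the basis vector `e (i-1)`, `1 ≤ i ≤ 2k+2`. -/
noncomputable def bimodN (k : ℕ) : Bimodule K := stringBimodule K 1 (2 * k + 2)

/-- `M_k`, with `m_i` the basis vector `e (i-1)`, `1 ≤ i ≤ 2k+3`. -/
noncomputable def bimodM (k : ℕ) : Bimodule K := stringBimodule K 1 (2 * k + 3)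

/-- The 1-morphism `W_k`. -/
noncomputable abbrev W (k : ℕ) : EndoD K := (bimodW K k).tensorFunctor

/-- The 1-morphism `S_k`. -/
noncomputable abbrev S (k : ℕ) : EndoD K := (bimodS K k).tensorFunctor

/-- The 1-morphism `N_k`. -/
noncomputable abbrev N (k : ℕ) : EndoD K := (bimodN K k).tensorFunctor

/-- The 1-morphism `M_k`. -/
noncomputable abbrev M (k : ℕ) : EndoD K := (bimodM K k).tensorFunctor

/-- The element `w_1 + w_3 + ⋯ + w_{2k+1}` of `W_k`. -/
def sumTop (k : ℕ) : Fin (2 * k + 1) → K := fun j => if Even j.1 then 1 else 0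

theorem leftX_sumTop (k : ℕ) :
    leftX K 0 (2 * k + 1) (sumTop K k) = rightX K 0 (2 * k + 1) (sumTop K k) := by
  funext j
  simp only [leftX, rightX, sumTop, LinearMap.coe_mk, AddHom.coe_mk]
  grind

/-- The 2-morphism `ψ_k : 𝟙 ⟶ W_k` given by the bimodule homomorphism `D → W_k` with
`1 ↦ w_1 + w_3 + ⋯ + w_{2k+1}`; hence `x ↦ w_2 + w_4 + ⋯ + w_{2k}`. -/
noncomputable def psi (k : ℕ) : 𝟭 (DMod K) ⟶ W K k :=
  (bimodW K k).ofCentral (sumTop K k)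
    (Bimodule.ofOperators_central (hl := leftX_sq K _ _) (hr := rightX_sq K _ _)
      (hlr := leftX_mul_rightX K _ _) (sumTop K k) (leftX_sumTop K k))

end Strings

section Cells

variable {K : Type u} [Field K]

/-- `F ≤_L G`: `G` is a direct summand of `H ∘ F` for some 1-morphism `H`. Here and below `P` is
the class of 1-morphisms of a 2-full 2-subcategory of endofunctors of `D`-mod; its 2-morphisms are
all natural transformations. -/
def LeftLE (P : ObjectProperty (EndoD K)) (F G : EndoD K) : Prop :=
  ∃ H, P H ∧ Nonempty (Retract G (F ⋙ H))

/-- `F ≤_J G`: `G` is a direct summand of `H₁ ∘ F ∘ H₂` for some 1-morphisms `H₁`, `H₂`. -/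
def TwoSidedLE (P : ObjectProperty (EndoD K)) (F G : EndoD K) : Prop :=
  ∃ H₁ H₂, P H₁ ∧ P H₂ ∧ Nonempty (Retract G (H₂ ⋙ F ⋙ H₁))

/-- `L` is a left cell of `P`: an equivalence class of indecomposable 1-morphisms for the
equivalence relation induced by `≤_L` (as a class of 1-morphisms closed under isomorphism). -/
def IsLeftCell (P : ObjectProperty (EndoD K)) (L : Set (EndoD K)) : Prop :=
  ∃ F, P F ∧ Indecomposable F ∧
    L = {G | P G ∧ Indecomposable G ∧ LeftLE P F G ∧ LeftLE P G F}

/-- The 1-morphism `H` is co-good for `L` via `ψ : 𝟙 ⟶ H`: `Fψ` is left split for all `F ∈ L`. -/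
def IsCoGoodVia (P : ObjectProperty (EndoD K)) (L : Set (EndoD K)) (H : EndoD K)
    (ψ : 𝟭 (DMod K) ⟶ H) : Prop :=
  P H ∧ ∀ F ∈ L, IsSplitMono (Functor.whiskerRight ψ F)

/-- The 1-morphism `H` is co-great for `L` via `ψ : 𝟙 ⟶ H`: it is co-good via `ψ`, and `ψ` factors
through `ψ'` whenever a 1-morphism `H'` is co-good for `L` via `ψ'`. -/
def IsCoGreatVia (P : ObjectProperty (EndoD K)) (L : Set (EndoD K)) (H : EndoD K)
    (ψ : 𝟭 (DMod K) ⟶ H) : Prop :=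
  IsCoGoodVia P L H ψ ∧
    ∀ (H' : EndoD K) (ψ' : 𝟭 (DMod K) ⟶ H'), IsCoGoodVia P L H' ψ' →
      ∃ γ : H' ⟶ H, ψ = ψ' ≫ γ

/-- `H` is co-great for `L`. -/
def IsCoGreat (P : ObjectProperty (EndoD K)) (L : Set (EndoD K)) (H : EndoD K) : Prop :=
  ∃ ψ : 𝟭 (DMod K) ⟶ H, IsCoGreatVia P L H ψ

variable (K)

/-- The 2-category `𝒟`: its 1-morphisms are the endofunctors of `D`-mod isomorphic to tensoring
with a finite dimensional `D`-`D`-bimodule. -/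
def catD : ObjectProperty (EndoD K) := fun F => ∃ U : Bimodule K, Nonempty (F ≅ U.tensorFunctor)

/-- The two-sided cell `𝒥_k` of `𝒟` formed by `W_k`, `S_k`, `N_k` and `M_k`. -/
def cellJ (k : ℕ) : Set (EndoD K) :=
  {F | Nonempty (F ≅ W K k) ∨ Nonempty (F ≅ S K k) ∨ Nonempty (F ≅ N K k) ∨ Nonempty (F ≅ M K k)}

/-- The 1-morphism `G` of `𝒟` is indecomposable and lies in a two-sided cell `𝒥 ≥_J 𝒥_m`. -/
def AboveJ (m : ℕ) (G : EndoD K) : Prop :=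
  catD K G ∧ Indecomposable G ∧ ∃ U ∈ cellJ K m, TwoSidedLE (catD K) U G

/-- The 2-category `𝒟^(m)`: the additive closure in `𝒟` of the identity and all 1-morphisms in
two-sided cells `𝒥 ≥_J 𝒥_m`. -/
noncomputable def catDm (m : ℕ) : ObjectProperty (EndoD K) := fun F =>
  catD K F ∧ ∃ (n : ℕ) (G : Fin n → EndoD K),
    (∀ i, Nonempty (G i ≅ 𝟭 (DMod K)) ∨ AboveJ K m (G i)) ∧ Nonempty (Retract F (⨁ G))

/-- The class `{W_k, S_k}`, up to isomorphism. -/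
def cellWS (k : ℕ) : Set (EndoD K) := {F | Nonempty (F ≅ W K k) ∨ Nonempty (F ≅ S K k)}

end Cells

end DualBimod

/-! ### Endofunctors and natural transformations determined on the regular module. -/

namespace DualBimod

variable {K : Type u} [Field K]

/-! Everything is computed with strings: `str K n` has basis `e 0, …, e (n-1)` starting at a top
vector, so `W_k` and `S_k` are the strings of lengths `2k+1` and `2k+2`. A natural transformation
out of `U ⊗ -` is determined on `D`, hence the problem is linear algebra of bimodules.

Membership in the cell. The multiplication `e (2i) ⊗ e (2i) ↦ e (2i)` makes the sum of top vectors
of `W_k` a right unit for every string of length at most `2k+2`. This splits `Fψ_k` and gives `W_k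
≤_L F` for both `F` in the cell (`retractStr`). A section of the same multiplication gives `S_k ≤_L
W_k` (`nonempty_retract_comp`).

Nothing else lies in the cell. The invariant is a unit chain: left-linear endomorphisms `f_0, …,
f_k` of `F(D)` with sum `1`, where `f_i` after right multiplication by `x` equals right
multiplication after `f_{i+1}`, and `x` kills the image of `f_0` on the right. On a string these are
the projections to the blocks `{e (2i), e (2i+1)}`. The conditions are linear in `f`, so unit chains
pass to direct summands of `A ∘ F` (`IsUnitChain.transfer`). On `W_k` the leading coefficient of
`f_0` is `1`, and it can also be read off `f_k`. So a functor `F` with `W_k` a summand of `A ∘ F`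
has no unit chain shorter than `k`, and for `U` with a chain of length `k` the image of `f_0²` is
not contained in `Ux`. If `U` is indecomposable, this rules out `xUx ≠ 0` and produces a vector `g`
with `gx = 0` outside `xU + Ux`. A string is grown from `g` inside `U`. Where it stops, linear
duality supplies a homomorphism back to the string, and Fitting's lemma makes `U` a string
(`nonempty_iso_str`). The chain bounds leave only `W_k` and `S_k` (`IsUnitChain.iso_str`).

Co-greatness. A left inverse of `W_k ψ'` is a map `ρ : W_k ⊗ U → W_k` with `ρ(w ⊗ u₀) = w`. Its
diagonal coefficients form a bimodule map `U → W_k` sending `u₀` to the sum of top vectors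
(`exists_factor`). -/

variable (K) in
/-- The regular module, as an object of `D`-mod. -/
noncomputable abbrev regular : DMod K := FGModuleCat.of (DualNumber K) (DualNumber K)

/-- The morphism from the regular module that sends `1` to `y`. -/
noncomputable def point (X : DMod K) (y : X) : regular K ⟶ X :=
  FGModuleCat.ofHom (LinearMap.toSpanSingleton (DualNumber K) X y)

theorem point_apply (X : DMod K) (y : X) (d : DualNumber K) : (point X y).hom.hom d = d • y := rfl

theorem point_comp {X Y : DMod K} (y : X) (f : X ⟶ Y) : point X y ≫ f = point Y (f.hom.hom y) := by
  apply FGModuleCat.hom_ext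
  apply LinearMap.ext
  intro d
  exact (f.hom.hom).map_smul d y

theorem point_add (X : DMod K) (y z : X) : point X (y + z) = point X y + point X z := by
  apply FGModuleCat.hom_ext
  apply LinearMap.ext
  intro d
  exact smul_add d y z

theorem point_smul (X : DMod K) (d : DualNumber K) (y : X) :
    point X (d • y) = point (regular K) d ≫ point X y := by
  rw [point_comp]; rfl

/-- Right multiplication by `x` on the value of a functor at the regular module. -/
noncomputable def right (F : EndoD K) : F.obj (regular K) ⟶ F.obj (regular K) :=
  F.map (point (regular K) (DualNumber.eps : DualNumber K))

namespace Bimodule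

theorem tensor_hom_ext {U : Bimodule K} {F G : EndoD K} {τ τ' : F ⋙ U.tensorFunctor ⟶ G}
    (h : ∀ (X : DMod K) (u : U.carrier) (y : F.obj X),
      (τ.app X).hom.hom (U.pure u y) = (τ'.app X).hom.hom (U.pure u y)) : τ = τ' := by
  ext X t
  induction t using TensorProduct.induction_on with
  | zero => exact (map_zero (τ.app X).hom.hom).trans (map_zero (τ'.app X).hom.hom).symm
  | tmul u y => exact h X u y
  | add a b ha hb =>
    exact (map_add (τ.app X).hom.hom a b).trans ((congrArg₂ (· + ·) ha hb).trans
      (map_add (τ'.app X).hom.hom a b).symm)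

/-- Every `y` in `X` is the image of `1` under `D → X`, so naturality along `point X y` recovers the
transformation from its values on `u ⊗ 1`. -/
theorem hom_ext {U : Bimodule K} {G : EndoD K} {τ τ' : U.tensorFunctor ⟶ G}
    (h : ∀ u : U.carrier, (τ.app (regular K)).hom.hom (U.pure u (1 : DualNumber K)) =
      (τ'.app (regular K)).hom.hom (U.pure u (1 : DualNumber K))) : τ = τ' := by
  refine tensor_hom_ext (F := 𝟭 _) (τ := τ) (τ' := τ') fun X u y => ?_
  have key : ∀ σ : U.tensorFunctor ⟶ G, (σ.app X).hom.hom (U.pure u y) =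
      (G.map (point X y)).hom.hom ((σ.app (regular K)).hom.hom (U.pure u (1 : DualNumber K))) := by
    intro σ
    have h1 := congrArg (fun f => f.hom.hom (U.pure u (1 : DualNumber K))) (σ.naturality (point X y))
    have h2 : U.pure u y = U.tensorMap (point X y).hom.hom (U.pure u (1 : DualNumber K)) := by
      rw [tensorMap_pure, point_apply, one_smul]
    rw [h2]
    exact h1
  exact (key τ).trans ((congrArg _ (h u)).trans (key τ').symm)

/-- The additive map out of `U ⊗_D Y` defined by a balanced biadditive map, `D`-linear for the
left action. -/
noncomputable def liftTensor (U : Bimodule K) {Y Z : Type u} [AddCommGroup Y]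
    [Module (DualNumber K) Y] [AddCommGroup Z] [Module (DualNumber K) Z]
    (φ : U.carrier →+ Y →+ Z) (bal : ∀ (d : DualNumber K) u y, φ (d • u) y = φ u (d • y))
    (left : ∀ (d : DualNumber K) u y, φ (U.left d u) y = d • φ u y) : U.Tensor Y →ₗ[DualNumber K] Z where
  toFun := TensorProduct.liftAddHom φ bal
  map_add' := map_add (TensorProduct.liftAddHom φ bal)
  map_smul' d t := by
    induction t using TensorProduct.induction_on with
    | zero =>
      refine (congrArg _ (smul_zero (A := U.Tensor Y) d)).trans ?_
      refine (map_zero (TensorProduct.liftAddHom φ bal)).trans ?_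
      refine (smul_zero d).symm.trans ?_
      exact congrArg (d • ·) (map_zero (TensorProduct.liftAddHom φ bal)).symm
    | tmul u y => exact left d u y
    | add a b ha hb =>
      refine (congrArg _ (smul_add (A := U.Tensor Y) d a b)).trans ?_
      refine (map_add (TensorProduct.liftAddHom φ bal) _ _).trans ?_
      rw [ha, hb, ← smul_add]
      exact congrArg (d • ·) (map_add (TensorProduct.liftAddHom φ bal) a b).symm

/-- The natural transformation out of `U ⊗_D F(-)` defined by natural balanced biadditive maps. -/
noncomputable def tensorDesc (U : Bimodule K) (F G : EndoD K)
    (φ : ∀ X : DMod K, U.carrier →+ F.obj X →+ G.obj X)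
    (bal : ∀ X (d : DualNumber K) u y, φ X (d • u) y = φ X u (d • y))
    (left : ∀ X (d : DualNumber K) u y, φ X (U.left d u) y = d • φ X u y)
    (nat : ∀ (X Y : DMod K) (f : X ⟶ Y) u (y : F.obj X),
      φ Y u ((F.map f).hom.hom y) = (G.map f).hom.hom (φ X u y)) :
    F ⋙ U.tensorFunctor ⟶ G where
  app X := FGModuleCat.ofHom (U.liftTensor (φ X) (bal X) (left X))
  naturality X Y f := by
    ext t
    have h : (U.liftTensor (φ Y) (bal Y) (left Y)).comp (U.tensorMap (F.map f).hom.hom) =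
        (G.map f).hom.hom.comp (U.liftTensor (φ X) (bal X) (left X)) := by
      apply LinearMap.ext
      intro t
      induction t using TensorProduct.induction_on with
      | zero => exact (map_zero (LinearMap.comp _ _)).trans (map_zero (LinearMap.comp _ _)).symm
      | tmul u y => exact nat X Y f u y
      | add a b ha hb =>
        exact (map_add (LinearMap.comp _ _) a b).trans ((congrArg₂ (· + ·) ha hb).trans
          (map_add (LinearMap.comp _ _) a b).symm)
    exact LinearMap.congr_fun h t

instance (U : Bimodule K) : U.tensorFunctor.Additive where
  map_add {X Y f g} := by
    ext t
    exact LinearMap.congr_fun (LinearMap.lTensor_add U.carrier f.hom.hom g.hom.hom) t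

/-- The natural transformation `U ⊗_D - ⟶ G` defined by a map from `U` to the value of `G` at the
regular module. -/
noncomputable def desc (U : Bimodule K) (G : EndoD K) [G.Additive]
    (j : U.carrier →+ G.obj (regular K)) (left : ∀ (d : DualNumber K) u, j (U.left d u) = d • j u)
    (right : ∀ (d : DualNumber K) u, j (d • u) = (G.map (point (regular K) d)).hom.hom (j u)) :
    U.tensorFunctor ⟶ G :=
  U.tensorDesc (𝟭 _) G
    -- Naturality along `point X y` forces this formula; additivity of `G` makes it additive in `y`.
    (fun X => AddMonoidHom.mk' (fun u => AddMonoidHom.mk'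
        (fun y => (G.map (point X y)).hom.hom (j u)) (fun y z => by
          rw [point_add, G.map_add]; rfl))
      (fun u v => by
        ext y
        change (G.map (point X y)).hom.hom (j (u + v)) =
          (G.map (point X y)).hom.hom (j u) + (G.map (point X y)).hom.hom (j v)
        rw [map_add, map_add]))
    (fun X d u y => by
      change (G.map (point X y)).hom.hom (j (d • u)) = (G.map (point X (d • y))).hom.hom (j u)
      rw [right, point_smul, G.map_comp]; rfl)
    (fun X d u y => by
      change (G.map (point X y)).hom.hom (j (U.left d u)) = d • (G.map (point X y)).hom.hom (j u)
      rw [left, map_smul])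
    (fun X Y f u y => by
      change (G.map (point Y (f.hom.hom y))).hom.hom (j u) =
        (G.map f).hom.hom ((G.map (point X y)).hom.hom (j u))
      rw [← point_comp, G.map_comp]; rfl)

theorem desc_pure (U : Bimodule K) (G : EndoD K) [G.Additive]
    (j : U.carrier →+ G.obj (regular K)) (left right) (X : DMod K) (u : U.carrier) (y : X) :
    ((U.desc G j left right).app X).hom.hom (U.pure u y) = (G.map (point X y)).hom.hom (j u) := rfl

end Bimodule

end DualBimod

/-! ### Bimodule homomorphisms as linear maps commuting with two square-zero operators. -/

namespace DualBimod

variable {K : Type u} [Field K]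

theorem dual_eq (d : DualNumber K) :
    d = algebraMap K _ d.fst + algebraMap K (DualNumber K) d.snd * DualNumber.eps := by
  ext <;> simp [TrivSqZeroExt.algebraMap_eq_inl]

namespace Bimodule

/-- Left multiplication by `x`. -/
noncomputable def lx (U : Bimodule K) : Module.End K U.carrier where
  toFun u := U.left DualNumber.eps u
  map_add' := map_add _
  map_smul' c u := by
    rw [RingHom.id_apply, ← algebraMap_smul (DualNumber K) c u, map_smul, algebraMap_smul]

/-- Right multiplication by `x`. -/
noncomputable def rx (U : Bimodule K) : Module.End K U.carrier where
  toFun u := (DualNumber.eps : DualNumber K) • u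
  map_add' := smul_add _
  map_smul' c u := smul_comm _ c u

variable (U V Z : Bimodule K)

theorem lx_apply (u : U.carrier) : U.lx u = U.left DualNumber.eps u := rfl

theorem rx_apply (u : U.carrier) : U.rx u = (DualNumber.eps : DualNumber K) • u := rfl

theorem left_eq (d : DualNumber K) (u : U.carrier) :
    U.left d u = d.fst • u + d.snd • U.lx u := by
  conv_lhs => rw [dual_eq d]
  rw [map_add, map_mul, LinearMap.add_apply, Module.End.mul_apply, left_base, left_base, lx_apply]

theorem smul_eq (d : DualNumber K) (u : U.carrier) :
    d • u = d.fst • u + d.snd • U.rx u := by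
  conv_lhs => rw [dual_eq d]
  rw [add_smul, mul_smul, algebraMap_smul, algebraMap_smul, rx_apply]

theorem lx_lx (u : U.carrier) : U.lx (U.lx u) = 0 := by
  rw [lx_apply, lx_apply, ← Module.End.mul_apply, ← map_mul, DualNumber.eps_mul_eps, map_zero,
    LinearMap.zero_apply]

theorem rx_rx (u : U.carrier) : U.rx (U.rx u) = 0 := by
  rw [rx_apply, rx_apply, ← mul_smul, DualNumber.eps_mul_eps, zero_smul]

theorem rx_lx (u : U.carrier) : U.rx (U.lx u) = U.lx (U.rx u) := by
  rw [rx_apply, rx_apply, lx_apply, lx_apply, map_smul]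

variable {U V Z}

/-- The natural transformation given by a linear map commuting with both actions. -/
noncomputable def mapHom (φ : U.carrier →ₗ[K] V.carrier) (hl : ∀ u, φ (U.lx u) = V.lx (φ u))
    (hr : ∀ u, φ (U.rx u) = V.rx (φ u)) : U.tensorFunctor ⟶ V.tensorFunctor :=
  U.tensorDesc (𝟭 _) V.tensorFunctor
    (fun X => AddMonoidHom.mk' (fun u => AddMonoidHom.mk'
        (fun y => V.pure (φ u) y) (fun y z => V.pure_add _ y z))
      (fun u v => by
        ext y
        change V.pure (φ (u + v)) y = V.pure (φ u) y + V.pure (φ v) y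
        rw [map_add, add_pure]))
    (fun X d u y => by
      change V.pure (φ (d • u)) y = V.pure (φ u) (d • y)
      rw [pure_smul, smul_eq, smul_eq, map_add, map_smul, map_smul, hr])
    (fun X d u y => by
      change V.pure (φ (U.left d u)) y = d • V.pure (φ u) y
      rw [smul_pure, left_eq, left_eq, map_add, map_smul, map_smul, hl])
    (fun X Y f u y => rfl)

/-- The natural transformation `U ⊗_D V ⊗_D - ⟶ Z ⊗_D -` given by a balanced bilinear map. -/
noncomputable def mulHom (μ : U.carrier →ₗ[K] V.carrier →ₗ[K] Z.carrier)
    (hb : ∀ u v, μ (U.rx u) v = μ u (V.lx v)) (hl : ∀ u v, μ (U.lx u) v = Z.lx (μ u v))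
    (hr : ∀ u v, μ u (V.rx v) = Z.rx (μ u v)) :
    V.tensorFunctor ⋙ U.tensorFunctor ⟶ Z.tensorFunctor :=
  -- For fixed `u` the map `μ u` respects the right actions, so it can be tensored with `X` over
  -- `D`.
  let m (u : U.carrier) : V.carrier →ₗ[DualNumber K] Z.carrier :=
    { toFun := μ u
      map_add' := map_add _
      map_smul' := fun d v => by
        rw [RingHom.id_apply, smul_eq, smul_eq, map_add, map_smul, map_smul, hr] }
  have m_add (u v : U.carrier) : m (u + v) = m u + m v :=
    LinearMap.ext fun y => LinearMap.congr_fun (μ.map_add u v) y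
  U.tensorDesc V.tensorFunctor Z.tensorFunctor
    (fun X => AddMonoidHom.mk' (fun u => (LinearMap.rTensor X (m u)).toAddMonoidHom)
      (fun u v => by
        ext y
        change LinearMap.rTensor X (m (u + v)) y =
          (LinearMap.rTensor X (m u) + LinearMap.rTensor X (m v)) y
        rw [m_add, LinearMap.rTensor_add]))
    (fun X d u y => by
      change LinearMap.rTensor X (m (d • u)) y =
        ((LinearMap.rTensor X (m u)).comp (LinearMap.rTensor X (V.left d))) y
      rw [← LinearMap.rTensor_comp]
      congr 2
      ext v
      change μ (d • u) v = μ u (V.left d v)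
      rw [smul_eq, left_eq, map_add, map_add, map_smul, map_smul, LinearMap.add_apply,
        LinearMap.smul_apply, LinearMap.smul_apply, map_smul, map_smul, hb])
    (fun X d u y => by
      change LinearMap.rTensor X (m (U.left d u)) y =
        ((LinearMap.rTensor X (Z.left d)).comp (LinearMap.rTensor X (m u))) y
      rw [← LinearMap.rTensor_comp]
      congr 2
      ext v
      change μ (U.left d u) v = Z.left d (μ u v)
      rw [left_eq, left_eq, map_add, map_smul, map_smul, LinearMap.add_apply,
        LinearMap.smul_apply, LinearMap.smul_apply, hl])
    (fun X Y f u y => by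
      change ((LinearMap.rTensor Y (m u)).comp (LinearMap.lTensor V.carrier f.hom.hom)) y =
        ((LinearMap.lTensor Z.carrier f.hom.hom).comp (LinearMap.rTensor X (m u))) y
      rw [LinearMap.rTensor_comp_lTensor, LinearMap.lTensor_comp_rTensor])

variable (U) in
/-- The identification of `U ⊗_D D` with `U`. -/
noncomputable def rid : U.Tensor (DualNumber K) ≃+ U.carrier :=
  (TensorProduct.rid (DualNumber K) U.carrier).toAddEquiv

theorem rid_pure (u : U.carrier) (d : DualNumber K) : U.rid (U.pure u d) = d • u :=
  TensorProduct.rid_tmul u d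

theorem rid_pure_one (u : U.carrier) : U.rid (U.pure u 1) = u := by rw [rid_pure, one_smul]

theorem pure_rid (t : U.Tensor (DualNumber K)) : U.pure (U.rid t) 1 = t := by
  apply U.rid.injective
  rw [rid_pure_one]

theorem rid_smul (d : DualNumber K) (t : U.Tensor (DualNumber K)) :
    U.rid (d • t) = U.left d (U.rid t) := by
  rw [← pure_rid t, smul_pure, rid_pure_one, rid_pure_one]

/-- The linear map `U → V` underlying a homomorphism of left modules `U ⊗_D D ⟶ V ⊗_D D`. -/
noncomputable def toLin
    (h : U.tensorFunctor.obj (regular K) ⟶ V.tensorFunctor.obj (regular K)) :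
    U.carrier →ₗ[K] V.carrier where
  toFun u := V.rid (h.hom.hom (U.pure u (1 : DualNumber K)))
  map_add' u v := by
    refine (congrArg (fun t => V.rid (h.hom.hom t)) (U.add_pure u v (1 : DualNumber K))).trans ?_
    refine (congrArg V.rid (map_add h.hom.hom _ _)).trans ?_
    exact map_add V.rid _ _
  map_smul' c u := by
    have h1 : U.pure (c • u) (1 : DualNumber K) =
        algebraMap K (DualNumber K) c • U.pure u (1 : DualNumber K) := by
      rw [smul_pure, left_base]
    refine (congrArg (fun t => V.rid (h.hom.hom t)) h1).trans ?_
    refine (congrArg V.rid (map_smul h.hom.hom _ _)).trans ?_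
    exact (rid_smul _ _).trans (left_base V c _)

theorem pure_toLin (h : U.tensorFunctor.obj (regular K) ⟶ V.tensorFunctor.obj (regular K))
    (u : U.carrier) : V.pure (toLin h u) (1 : DualNumber K) =
      h.hom.hom (U.pure u (1 : DualNumber K)) := pure_rid _

theorem toLin_lx (h : U.tensorFunctor.obj (regular K) ⟶ V.tensorFunctor.obj (regular K))
    (u : U.carrier) : toLin h (U.lx u) = V.lx (toLin h u) := by
  have h1 : U.pure (U.lx u) (1 : DualNumber K) =
      (DualNumber.eps : DualNumber K) • U.pure u (1 : DualNumber K) := (smul_pure _ _ _ _).symm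
  refine (congrArg (fun t => V.rid (h.hom.hom t)) h1).trans ?_
  refine (congrArg V.rid (map_smul h.hom.hom _ _)).trans ?_
  exact rid_smul _ _

theorem toLin_id : toLin (𝟙 (U.tensorFunctor.obj (regular K))) = LinearMap.id :=
  LinearMap.ext fun u => rid_pure_one u

theorem toLin_comp (h : U.tensorFunctor.obj (regular K) ⟶ V.tensorFunctor.obj (regular K))
    (h' : V.tensorFunctor.obj (regular K) ⟶ Z.tensorFunctor.obj (regular K)) :
    toLin (h ≫ h') = (toLin h').comp (toLin h) := by
  refine LinearMap.ext fun u => ?_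
  change Z.rid (h'.hom.hom (h.hom.hom (U.pure u (1 : DualNumber K)))) = toLin h' (toLin h u)
  rw [← pure_toLin h u]
  rfl

theorem toLin_add (h h' : U.tensorFunctor.obj (regular K) ⟶ V.tensorFunctor.obj (regular K)) :
    toLin (h + h') = toLin h + toLin h' :=
  LinearMap.ext fun _ => map_add V.rid _ _

theorem toLin_zero :
    toLin (0 : U.tensorFunctor.obj (regular K) ⟶ V.tensorFunctor.obj (regular K)) = 0 :=
  LinearMap.ext fun _ => map_zero V.rid

theorem toLin_injective : Function.Injective
    (toLin : (U.tensorFunctor.obj (regular K) ⟶ V.tensorFunctor.obj (regular K)) → _) := by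
  intro h h' e
  apply FGModuleCat.hom_ext
  refine LinearMap.ext fun (t : U.Tensor (DualNumber K)) => ?_
  rw [← pure_rid t]
  exact (pure_toLin h _).symm.trans ((congrArg (fun f => V.pure (f (U.rid t)) _) e).trans
    (pure_toLin h' _))

theorem toLin_right : toLin (right U.tensorFunctor) = U.rx := by
  refine LinearMap.ext fun u => ?_
  change U.rid (U.pure u ((1 : DualNumber K) • DualNumber.eps)) = _
  rw [rid_pure, one_smul, rx_apply]

/-- A single morphism on `D` respects only the left action. Compatibility with the right action is
naturality along multiplication by `x` on `D`. -/
theorem toLin_app_rx (τ : U.tensorFunctor ⟶ V.tensorFunctor) (u : U.carrier) :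
    toLin (τ.app (regular K)) (U.rx u) = V.rx (toLin (τ.app (regular K)) u) := by
  have h := τ.naturality (point (regular K) (DualNumber.eps : DualNumber K))
  have h' := congrArg toLin h
  rw [toLin_comp, toLin_comp] at h'
  have h2 := LinearMap.congr_fun h' u
  rw [LinearMap.comp_apply, LinearMap.comp_apply] at h2
  have e1 : toLin (U.tensorFunctor.map (point (regular K) (DualNumber.eps : DualNumber K))) =
    U.rx := toLin_right
  have e2 : toLin (V.tensorFunctor.map (point (regular K) (DualNumber.eps : DualNumber K))) =
    V.rx := toLin_right
  rw [e1, e2] at h2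
  exact h2

theorem hom_ext_toLin {τ τ' : U.tensorFunctor ⟶ V.tensorFunctor}
    (h : toLin (τ.app (regular K)) = toLin (τ'.app (regular K))) : τ = τ' :=
  hom_ext fun u => by rw [toLin_injective h]

theorem toLin_mapHom (φ : U.carrier →ₗ[K] V.carrier) (hl hr) :
    toLin ((mapHom φ hl hr).app (regular K)) = φ :=
  LinearMap.ext fun u => rid_pure_one (φ u)

/-- The homomorphism of left modules `U ⊗_D D ⟶ V ⊗_D D` given by a linear map `U → V` that
commutes with the left actions. -/
noncomputable def ofLin (φ : U.carrier →ₗ[K] V.carrier) (hl : ∀ u, φ (U.lx u) = V.lx (φ u)) :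
    U.tensorFunctor.obj (regular K) ⟶ V.tensorFunctor.obj (regular K) :=
  FGModuleCat.ofHom (V := U.Tensor (DualNumber K)) (W := V.Tensor (DualNumber K))
    { toFun := fun t => V.pure (φ (U.rid t)) (1 : DualNumber K)
      map_add' := fun s t => by rw [map_add, map_add, add_pure]
      map_smul' := fun d t => by
        rw [RingHom.id_apply, smul_pure, rid_smul, left_eq, left_eq, map_add, map_smul, map_smul,
          hl] }

theorem toLin_ofLin (φ : U.carrier →ₗ[K] V.carrier) (hl) : toLin (ofLin φ hl) = φ := by
  refine LinearMap.ext fun u => ?_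
  change V.rid (V.pure (φ (U.rid (U.pure u 1))) 1) = _
  rw [rid_pure_one, rid_pure_one]

theorem isIso_of_toLin_bijective (τ : U.tensorFunctor ⟶ V.tensorFunctor)
    (h : Function.Bijective (toLin (τ.app (regular K)))) : IsIso τ := by
  let e := LinearEquiv.ofBijective _ h
  refine ⟨mapHom e.symm.toLinearMap (fun u => ?_) (fun u => ?_), hom_ext_toLin ?_, hom_ext_toLin ?_⟩
  · refine e.injective ?_
    refine (e.apply_symm_apply _).trans ?_
    refine .trans ?_ (toLin_lx (τ.app (regular K)) (e.symm u)).symm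
    exact (congrArg V.lx (e.apply_symm_apply u)).symm
  · refine e.injective ?_
    refine (e.apply_symm_apply _).trans ?_
    refine .trans ?_ (toLin_app_rx τ (e.symm u)).symm
    exact (congrArg V.rx (e.apply_symm_apply u)).symm
  · rw [NatTrans.comp_app, toLin_comp, toLin_mapHom, NatTrans.id_app, toLin_id]
    exact LinearMap.ext e.symm_apply_apply
  · rw [NatTrans.comp_app, toLin_comp, toLin_mapHom, NatTrans.id_app, toLin_id]
    exact LinearMap.ext e.apply_symm_apply

end Bimodule

end DualBimod

/-! ### Coordinates on strings. -/

namespace DualBimod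

variable {K : Type u} [Field K]

open Bimodule

section StringCoordinates

variable (K) in
/-- The string bimodule of length `n` that starts at a top vector. -/
noncomputable abbrev str (n : ℕ) : Bimodule K := stringBimodule K 0 n

/-- The coordinates of an element of the string bimodule. -/
noncomputable def coords (n : ℕ) : (str K n).carrier ≃ₗ[K] (Fin n → K) :=
  LinearEquiv.refl K (Fin n → K)

/-- The `j`-th coordinate, which is zero for `j ≥ n`. -/
noncomputable def co (n j : ℕ) : (str K n).carrier →ₗ[K] K :=
  if h : j < n then (LinearMap.proj ⟨j, h⟩).comp (coords n).toLinearMap else 0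

/-- The element with prescribed coordinates. -/
noncomputable def ofCo (n : ℕ) (f : ℕ → K) : (str K n).carrier := (coords n).symm fun j => f j

variable {n : ℕ}

theorem co_ofCo (f : ℕ → K) (j : ℕ) : co n j (ofCo n f) = if j < n then f j else 0 := by
  unfold co ofCo
  split_ifs with h
  · simp
  · rfl

theorem co_of_le {j : ℕ} (h : n ≤ j) (v : (str K n).carrier) : co n j v = 0 := by
  unfold co
  rw [dif_neg (by omega)]
  rfl

theorem co_ext {v w : (str K n).carrier} (h : ∀ j, co n j v = co n j w) : v = w := by
  apply (coords n).injective
  funext j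
  have := h j
  unfold co at this
  rwa [dif_pos j.2] at this

theorem co_ext_parity {v w : (str K n).carrier} (h0 : ∀ i, co n (2 * i) v = co n (2 * i) w)
    (h1 : ∀ i, co n (2 * i + 1) v = co n (2 * i + 1) w) : v = w := by
  apply co_ext
  intro j
  obtain ⟨i, rfl | rfl⟩ := Nat.even_or_odd' j
  · exact h0 i
  · exact h1 i

theorem lx_str (v : (str K n).carrier) :
    (str K n).lx v = (coords n).symm (leftX K 0 n (coords n v)) := by
  have h1 : (str K n).lx v = algebraMap K (Module.End K (Fin n → K)) 0 (coords n v) +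
    algebraMap K (Module.End K (Fin n → K)) 1 (leftX K 0 n (coords n v)) := rfl
  rw [h1, map_zero, map_one, LinearMap.zero_apply, zero_add]
  rfl

theorem rx_str (v : (str K n).carrier) :
    (str K n).rx v = (coords n).symm (rightX K 0 n (coords n v)) := by
  have h1 : (str K n).rx v = algebraMap K (Module.End K (Fin n → K)) 0 (coords n v) +
    algebraMap K (Module.End K (Fin n → K)) 1 (rightX K 0 n (coords n v)) := rfl
  rw [h1, map_zero, map_one, LinearMap.zero_apply, zero_add]
  rfl

theorem co_lx_even (i : ℕ) (v : (str K n).carrier) : co n (2 * i) ((str K n).lx v) = 0 := by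
  rw [lx_str]
  unfold co
  split_ifs with h
  · simp [leftX]
  · rfl

theorem co_lx_odd (i : ℕ) (v : (str K n).carrier) :
    co n (2 * i + 1) ((str K n).lx v) = if 2 * i + 1 < n then co n (2 * i) v else 0 := by
  rw [lx_str]
  unfold co
  split_ifs with h h'
  · simp [leftX]
  · omega
  · rfl

theorem co_rx_even (i : ℕ) (v : (str K n).carrier) : co n (2 * i) ((str K n).rx v) = 0 := by
  rw [rx_str]
  unfold co
  split_ifs with h
  · simp [rightX]
  · rfl

theorem co_rx_odd (i : ℕ) (v : (str K n).carrier) :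
    co n (2 * i + 1) ((str K n).rx v) = co n (2 * i + 2) v := by
  rw [rx_str]
  unfold co
  split_ifs with h h' h'
  · simp [rightX, h']
  · simp [rightX, h']
  · omega
  · rfl

theorem co_zero_lx (v : (str K n).carrier) : co n 0 ((str K n).lx v) = 0 := co_lx_even 0 v

variable (K n) in
/-- The basis vector `e j`. -/
noncomputable def basisVec (j : ℕ) : (str K n).carrier := ofCo n fun i => if i = j then 1 else 0

theorem co_basisVec (i j : ℕ) :
    co n i (basisVec K n j) = if i = j ∧ i < n then 1 else 0 := by
  unfold basisVec
  rw [co_ofCo]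
  grind

theorem lx_basisVec_even {i : ℕ} (h : 2 * i + 1 < n) :
    (str K n).lx (basisVec K n (2 * i)) = basisVec K n (2 * i + 1) := by
  refine co_ext_parity (fun a => ?_) (fun a => ?_)
  · rw [co_lx_even, co_basisVec]; grind
  · rw [co_lx_odd, co_basisVec, co_basisVec]; grind

theorem lx_basisVec_of_le {j : ℕ} (h : n ≤ j + 1) : (str K n).lx (basisVec K n j) = 0 := by
  refine co_ext_parity (fun a => ?_) (fun a => ?_)
  · rw [co_lx_even, map_zero]
  · rw [co_lx_odd, co_basisVec, map_zero]; grind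

theorem lx_basisVec_odd (i : ℕ) : (str K n).lx (basisVec K n (2 * i + 1)) = 0 := by
  refine co_ext_parity (fun a => ?_) (fun a => ?_)
  · rw [co_lx_even, map_zero]
  · rw [co_lx_odd, co_basisVec, map_zero]; grind

theorem rx_basisVec_even {i : ℕ} (h : 2 * i + 2 < n) :
    (str K n).rx (basisVec K n (2 * i + 2)) = basisVec K n (2 * i + 1) := by
  refine co_ext_parity (fun a => ?_) (fun a => ?_)
  · rw [co_rx_even, co_basisVec]; grind
  · rw [co_rx_odd, co_basisVec, co_basisVec]; grind

theorem rx_basisVec_zero : (str K n).rx (basisVec K n 0) = 0 := by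
  refine co_ext_parity (fun a => ?_) (fun a => ?_)
  · rw [co_rx_even, map_zero]
  · rw [co_rx_odd, co_basisVec, map_zero]; grind

theorem rx_basisVec_odd (i : ℕ) : (str K n).rx (basisVec K n (2 * i + 1)) = 0 := by
  refine co_ext_parity (fun a => ?_) (fun a => ?_)
  · rw [co_rx_even, map_zero]
  · rw [co_rx_odd, co_basisVec, map_zero]; grind

theorem eq_sum_basisVec (v : (str K n).carrier) :
    v = ∑ j ∈ Finset.range n, co n j v • basisVec K n j := by
  refine co_ext fun i => ?_
  rw [map_sum]
  simp only [map_smul, co_basisVec, smul_eq_mul, mul_ite, mul_one, mul_zero]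
  by_cases hi : i < n
  · simp [hi]
  · simp [hi, co_of_le (not_lt.mp hi)]

theorem str_hom_ext {V : Type*} [AddCommGroup V] [Module K V] {f g : (str K n).carrier →ₗ[K] V}
    (h : ∀ j < n, f (basisVec K n j) = g (basisVec K n j)) : f = g := by
  refine LinearMap.ext fun v => ?_
  rw [eq_sum_basisVec v, map_sum, map_sum]
  refine Finset.sum_congr rfl fun j hj => ?_
  rw [map_smul, map_smul, h j (Finset.mem_range.mp hj)]

end StringCoordinates

/-! ### Multiplication of strings and the splitting of `ψ_k`. -/

section Multiplication

variable (n n' : ℕ)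

/-- The multiplication `e (2i) ⊗ e (2i) ↦ e (2i)` of string bimodules. -/
noncomputable def strMul :
    (str K n).carrier →ₗ[K] (str K n').carrier →ₗ[K] (str K n).carrier :=
  LinearMap.mk₂ K (fun v w => ofCo n fun j =>
      -- A bottom vector `e (2i+1)` arises from `e (2i+1) ⊗ e (2i)` and from `e (2i+2) ⊗ e (2i+1)`,
      -- which balancing over `x` identifies.
      if Even j then co n j v * co n' j w
      else co n j v * co n' (j - 1) w + co n (j + 1) v * co n' j w)
    (fun v v' w => co_ext fun j => by
      rw [map_add]; simp only [co_ofCo, map_add]; split_ifs <;> ring)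
    (fun c v w => co_ext fun j => by
      rw [map_smul]; simp only [co_ofCo, map_smul, smul_eq_mul]; split_ifs <;> ring)
    (fun v w w' => co_ext fun j => by
      rw [map_add]; simp only [co_ofCo, map_add]; split_ifs <;> ring)
    (fun c v w => co_ext fun j => by
      rw [map_smul]; simp only [co_ofCo, map_smul, smul_eq_mul]; split_ifs <;> ring)

variable {n n'}

theorem co_strMul_even (i : ℕ) (v : (str K n).carrier) (w : (str K n').carrier) :
    co n (2 * i) (strMul n n' v w) = co n (2 * i) v * co n' (2 * i) w := by
  simp only [strMul, LinearMap.mk₂_apply, co_ofCo, even_two, Even.mul_right, if_true]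
  split_ifs with h
  · rfl
  · rw [co_of_le (not_lt.mp h), zero_mul]

theorem co_strMul_odd (i : ℕ) (v : (str K n).carrier) (w : (str K n').carrier) :
    co n (2 * i + 1) (strMul n n' v w) =
      co n (2 * i + 1) v * co n' (2 * i) w + co n (2 * i + 2) v * co n' (2 * i + 1) w := by
  have h : ¬ Even (2 * i + 1) := by simp
  simp only [strMul, LinearMap.mk₂_apply, co_ofCo, h, if_false, Nat.add_sub_cancel]
  split_ifs with h
  · rfl
  · rw [co_of_le (j := 2 * i + 1) (by omega), co_of_le (j := 2 * i + 2) (by omega), zero_mul,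
      zero_mul, zero_add]

/-- The length bound is used at the end of the second string: if `x e (2i) = 0` there, then `e
(2i+2)` must already be missing from the first. -/
theorem strMul_rx_left (h : n ≤ n' + 1) (v : (str K n).carrier) (w : (str K n').carrier) :
    strMul n n' ((str K n).rx v) w = strMul n n' v ((str K n').lx w) := by
  refine co_ext_parity (fun i => ?_) (fun i => ?_)
  · rw [co_strMul_even, co_strMul_even, co_rx_even, co_lx_even]; ring
  · rw [co_strMul_odd, co_strMul_odd, co_rx_odd, co_lx_odd, co_lx_even,
      show 2 * i + 2 = 2 * (i + 1) by ring, co_rx_even]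
    split_ifs with h'
    · ring
    · rw [co_of_le (j := 2 * (i + 1)) (by omega)]; ring

theorem strMul_lx_left (v : (str K n).carrier) (w : (str K n').carrier) :
    strMul n n' ((str K n).lx v) w = (str K n).lx (strMul n n' v w) := by
  refine co_ext_parity (fun i => ?_) (fun i => ?_)
  · rw [co_strMul_even, co_lx_even, co_lx_even]; ring
  · rw [co_strMul_odd, co_lx_odd, co_lx_odd, co_strMul_even,
      show 2 * i + 2 = 2 * (i + 1) by ring, co_lx_even]
    split_ifs <;> ring

theorem strMul_rx_right (v : (str K n).carrier) (w : (str K n').carrier) :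
    strMul n n' v ((str K n').rx w) = (str K n).rx (strMul n n' v w) := by
  refine co_ext_parity (fun i => ?_) (fun i => ?_)
  · rw [co_strMul_even, co_rx_even, co_rx_even]; ring
  · rw [co_strMul_odd, co_rx_odd, co_rx_odd, show 2 * i + 2 = 2 * (i + 1) by ring, co_strMul_even,
      co_rx_even]
    ring

/-- The multiplication of string bimodules as a natural transformation. -/
noncomputable def strMulHom (h : n ≤ n' + 1) :
    (str K n').tensorFunctor ⋙ (str K n).tensorFunctor ⟶ (str K n).tensorFunctor :=
  mulHom (strMul n n') (strMul_rx_left h) strMul_lx_left strMul_rx_right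

variable (K) in
/-- The sum of the top vectors. -/
noncomputable def topSum (k : ℕ) : (str K (2 * k + 1)).carrier :=
  (coords _).symm (sumTop K k)

theorem co_topSum (k j : ℕ) :
    co (2 * k + 1) j (topSum K k) = if Even j ∧ j < 2 * k + 1 then 1 else 0 := by
  unfold co topSum
  split_ifs with h h' h'
  · simp [sumTop, h'.1]
  · simp only [LinearMap.comp_apply, LinearEquiv.coe_coe, LinearEquiv.apply_symm_apply,
      LinearMap.proj_apply, sumTop]
    rw [if_neg fun he => h' ⟨he, h⟩]
  · exact absurd h'.2 h
  · rfl

/-- All even indices below `2k+2` are at most `2k`, so `W_k` has a top vector for each top vector of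
the string. This is why one `ψ_k` serves both `W_k` and `S_k`. -/
theorem strMul_topSum {k : ℕ} (h : n ≤ 2 * k + 2) (v : (str K n).carrier) :
    strMul n (2 * k + 1) v (topSum K k) = v := by
  refine co_ext_parity (fun i => ?_) (fun i => ?_)
  · rw [co_strMul_even, co_topSum]
    by_cases hi : 2 * i < n
    · rw [if_pos (by constructor <;> [simp; omega]), mul_one]
    · rw [co_of_le (not_lt.mp hi), zero_mul]
  · rw [co_strMul_odd, co_topSum, co_topSum]
    by_cases hi : 2 * i < n
    · rw [if_pos (by constructor <;> [simp; omega]), if_neg (by simp), mul_one, mul_zero, add_zero]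
    · rw [co_of_le (j := 2 * i + 1) (by omega), co_of_le (j := 2 * i + 2) (by omega), zero_mul,
        zero_mul, add_zero]

variable (K) in
/-- The 2-morphism `ψ_k`. -/
noncomputable def strPsi (k : ℕ) : 𝟭 (DMod K) ⟶ (str K (2 * k + 1)).tensorFunctor := psi K k

theorem strPsi_app (k : ℕ) (X : DMod K) (y : X) :
    ((strPsi K k).app X).hom.hom y = (str K (2 * k + 1)).pure (topSum K k) y := rfl

/-- The 2-morphism `Fψ_k`, for `F` a string of length at most `2k+2`, is left split. -/
theorem whiskerRight_strPsi_strMulHom {k : ℕ} (h : n ≤ 2 * k + 2) :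
    Functor.whiskerRight (strPsi K k) (str K n).tensorFunctor ≫
      strMulHom (n := n) (n' := 2 * k + 1) (by omega) =
    (Functor.leftUnitor (str K n).tensorFunctor).hom := by
  refine tensor_hom_ext (F := 𝟭 _) fun X u y => ?_
  change ((str K n).pure (strMul n (2 * k + 1) u (topSum K k)) y) = (str K n).pure u y
  rw [strMul_topSum h]

/-- A string of length at most `2k+2` is a direct summand of its composition with `W_k`. -/
noncomputable def retractStr {k : ℕ} (h : n ≤ 2 * k + 2) :
    Retract (str K n).tensorFunctor ((str K (2 * k + 1)).tensorFunctor ⋙ (str K n).tensorFunctor) where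
  i := (Functor.leftUnitor (str K n).tensorFunctor).inv ≫
    Functor.whiskerRight (strPsi K k) (str K n).tensorFunctor
  r := strMulHom (n := n) (n' := 2 * k + 1) (by omega)
  retract := by
    rw [Category.assoc, whiskerRight_strPsi_strMulHom h, Iso.inv_hom_id]

end Multiplication

end DualBimod

/-! ### Maps out of strings, and `W_k` as a summand of `W_k ∘ S_k`. -/

namespace DualBimod

variable {K : Type u} [Field K]

open Bimodule

section StringDesc

variable {n : ℕ} {X : Type u} [AddCommGroup X] [Module (DualNumber K) X]

/-- The additive map out of a string bimodule with prescribed values on the basis vectors. -/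
noncomputable def strLift (n : ℕ) (E : ℕ → X) : (str K n).carrier →+ X where
  toFun v := ∑ i ∈ Finset.range n, algebraMap K (DualNumber K) (co n i v) • E i
  map_zero' := by simp
  map_add' v w := by simp [add_smul, Finset.sum_add_distrib]

theorem strLift_smul (E : ℕ → X) (c : K) (v : (str K n).carrier) :
    strLift n E (c • v) = algebraMap K (DualNumber K) c • strLift n E v := by
  simp only [strLift, AddMonoidHom.coe_mk, ZeroHom.coe_mk, map_smul, smul_eq_mul, map_mul,
    mul_smul, Finset.smul_sum]

theorem strLift_basisVec (E : ℕ → X) {i : ℕ} (h : i < n) :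
    strLift n E (basisVec K n i) = E i := by
  simp only [strLift, AddMonoidHom.coe_mk, ZeroHom.coe_mk, co_basisVec]
  rw [Finset.sum_eq_single i]
  · simp [h]
  · intro j _ hj
    simp [hj]
  · simp [h]

/-- An additive map out of a string bimodule intertwines two operators if it does so on the basis
vectors. -/
theorem strLift_intertwine (E : ℕ → X) (f : Module.End K (str K n).carrier)
    (g : X →ₗ[DualNumber K] X) (h : ∀ i < n, strLift n E (f (basisVec K n i)) = g (E i))
    (v : (str K n).carrier) : strLift n E (f v) = g (strLift n E v) := by
  rw [eq_sum_basisVec v]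
  simp only [map_sum]
  refine Finset.sum_congr rfl fun i hi => ?_
  have hi' := Finset.mem_range.mp hi
  rw [map_smul, strLift_smul, strLift_smul, map_smul, h i hi', strLift_basisVec E hi']

/-- The natural transformation out of a string bimodule with prescribed values on the basis
vectors. -/
noncomputable def strDesc (G : EndoD K) [G.Additive] (E : ℕ → G.obj (regular K))
    (hG : ∀ (c : K) (h : G.obj (regular K)),
      (G.map (point (regular K) (algebraMap K (DualNumber K) c))).hom.hom h =
        algebraMap K (DualNumber K) c • h)
    (hl : ∀ i < n, strLift n E ((str K n).lx (basisVec K n i)) = (DualNumber.eps : DualNumber K) • E i)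
    (hr : ∀ i < n, strLift n E ((str K n).rx (basisVec K n i)) = (right G).hom.hom (E i)) :
    (str K n).tensorFunctor ⟶ G :=
  (str K n).desc G (strLift n E)
    (fun d v => by
      have h := strLift_intertwine E (str K n).lx
        (LinearMap.lsmul (DualNumber K) (G.obj (regular K)) (DualNumber.eps : DualNumber K)) hl v
      rw [LinearMap.lsmul_apply] at h
      rw [left_eq, map_add, strLift_smul, strLift_smul, h, ← mul_smul, ← add_smul, ← dual_eq])
    (fun d v => by
      have h := strLift_intertwine E (str K n).rx (right G).hom.hom hr v
      -- Split `d` into its scalar part, governed by `hG`, and its `x` part, governed by `right G`.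
      have hd : point (regular K) d = point (regular K) (algebraMap K (DualNumber K) d.fst) +
          point (regular K) (DualNumber.eps : DualNumber K) ≫
            point (regular K) (algebraMap K (DualNumber K) d.snd) := by
        rw [← point_smul, ← point_add]
        congr 1
        rw [smul_eq_mul, mul_comm]
        exact dual_eq d
      rw [smul_eq, map_add, strLift_smul, strLift_smul, h, hd, G.map_add, G.map_comp, ← hG, ← hG]
      rfl)

theorem strDesc_basisVec (G : EndoD K) [G.Additive] (E : ℕ → G.obj (regular K)) (hG hl hr)
    {i : ℕ} (h : i < n) :
    ((strDesc (n := n) G E hG hl hr).app (regular K)).hom.hom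
      ((str K n).pure (basisVec K n i) (1 : DualNumber K)) = E i := by
  refine (desc_pure _ _ _ _ _ _ _ _).trans ?_
  rw [strLift_basisVec E h]
  have : point (regular K) (1 : DualNumber K) = 𝟙 _ := by
    apply FGModuleCat.hom_ext
    refine LinearMap.ext fun (d : DualNumber K) => ?_
    exact mul_one d
  refine (congrArg (fun f => (G.map f).hom.hom (E i)) this).trans ?_
  rw [G.map_id]
  rfl

end StringDesc

section Coproduct

/-- The elements `t ⊗ s` of `U ⊗_D V`. -/
noncomputable def tmul {U V : Bimodule K} (u : U.carrier) (v : V.carrier) :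
    (V.tensorFunctor ⋙ U.tensorFunctor).obj (regular K) :=
  U.pure (X := V.Tensor (DualNumber K)) u (V.pure v (1 : DualNumber K))

variable {U V : Bimodule K}

theorem tmul_zero (u : U.carrier) : tmul u (0 : V.carrier) = 0 := by
  unfold tmul
  rw [zero_pure, pure_zero]
  rfl

theorem zero_tmul (v : V.carrier) : tmul (0 : U.carrier) v = 0 := by
  unfold tmul
  rw [zero_pure]
  rfl

theorem eps_smul_tmul (u : U.carrier) (v : V.carrier) :
    (DualNumber.eps : DualNumber K) • tmul u v = tmul (U.lx u) v := rfl

theorem tmul_lx (u : U.carrier) (v : V.carrier) : tmul u (V.lx v) = tmul (U.rx u) v := by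
  unfold tmul
  rw [rx_apply, ← pure_smul, smul_pure, lx_apply]

theorem map_point_tmul (d : DualNumber K) (u : U.carrier) (v : V.carrier) :
    ((V.tensorFunctor ⋙ U.tensorFunctor).map (point (regular K) d)).hom.hom (tmul u v) =
      tmul u (d • v) := by
  have h : V.pure v ((1 : DualNumber K) • d) = V.pure (d • v) (1 : DualNumber K) := by
    rw [← pure_smul, smul_eq_mul, smul_eq_mul, mul_comm]
  exact congrArg (U.pure u) h

theorem right_tmul (u : U.carrier) (v : V.carrier) :
    (right (V.tensorFunctor ⋙ U.tensorFunctor)).hom.hom (tmul u v) = tmul u (V.rx v) :=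
  map_point_tmul _ _ _

theorem comp_tensor_induction {p : (V.tensorFunctor ⋙ U.tensorFunctor).obj (regular K) → Prop}
    (hz : p 0) (h : ∀ u v, p (tmul u v)) (ha : ∀ s t, p s → p t → p (s + t))
    (t : (V.tensorFunctor ⋙ U.tensorFunctor).obj (regular K)) : p t := by
  induction t using TensorProduct.induction_on with
  | zero => exact hz
  | tmul u y =>
    have h1 : tmul u (V.rid y) = U.pure u y :=
      congrArg (U.pure (X := V.Tensor (DualNumber K)) u) (pure_rid (U := V) y)
    have h2 := h u (V.rid y)
    rw [h1] at h2
    exact h2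
  | add a b ha' hb => exact ha a b ha' hb

/-- Scalars are central and pass through both tensor signs; this supplies the hypothesis `hG` of
`strDesc`. -/
theorem map_point_base (c : K) (t : (V.tensorFunctor ⋙ U.tensorFunctor).obj (regular K)) :
    ((V.tensorFunctor ⋙ U.tensorFunctor).map
      (point (regular K) (algebraMap K (DualNumber K) c))).hom.hom t =
        algebraMap K (DualNumber K) c • t := by
  induction t using comp_tensor_induction with
  | hz => rw [map_zero, smul_zero]
  | h u v =>
    rw [map_point_tmul]
    have h1 : algebraMap K (DualNumber K) c • tmul u v =
      tmul (U.left (algebraMap K (DualNumber K) c) u) v := rfl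
    have h2 : tmul u (V.left (algebraMap K (DualNumber K) c) v) =
      tmul (algebraMap K (DualNumber K) c • u) v := by
      unfold tmul
      rw [← pure_smul, smul_pure]
    rw [h1, left_base, algebraMap_smul, ← left_base V, h2, algebraMap_smul]
  | ha s t hs ht => rw [map_add, hs, ht, smul_add]

theorem toLin_comp_app {G : EndoD K} (τ : U.tensorFunctor ⟶ G) (σ : G ⟶ V.tensorFunctor)
    (u : U.carrier) : toLin ((τ ≫ σ).app (regular K)) u = V.rid ((σ.app (regular K)).hom.hom
      ((τ.app (regular K)).hom.hom (U.pure u (1 : DualNumber K)))) := rfl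

theorem strMulHom_tmul {n n' : ℕ} (h : n ≤ n' + 1) (u : (str K n).carrier)
    (v : (str K n').carrier) : ((strMulHom h).app (regular K)).hom.hom (tmul u v) =
      (str K n).pure (strMul n n' u v) (1 : DualNumber K) := rfl

theorem strMul_basisVec {n n' i : ℕ} (h : i < n' + i % 2) :
    strMul n n' (basisVec K n i) (basisVec K n' (2 * (i / 2))) = basisVec K n i := by
  refine co_ext fun j => ?_
  obtain ⟨a, rfl | rfl⟩ := Nat.even_or_odd' j
  · rw [co_strMul_even, co_basisVec, co_basisVec]
    split_ifs <;> first | omega | simp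
  · rw [co_strMul_odd, co_basisVec, co_basisVec, co_basisVec, co_basisVec]
    split_ifs <;> first | omega | simp

/-- `W_k` is a direct summand of `W_k ∘ S_k`. -/
theorem nonempty_retract_comp (k : ℕ) :
    Nonempty (Retract (str K (2 * k + 1)).tensorFunctor
      ((str K (2 * k + 2)).tensorFunctor ⋙ (str K (2 * k + 1)).tensorFunctor)) := by
  -- The section of the multiplication: `e (2i) ↦ e (2i) ⊗ e (2i)` and `e (2i+1) ↦ e (2i+1) ⊗ e
  -- (2i)`. A unit as in `W_k` is not available, since the sum of top vectors of `S_k` is not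
  -- central.
  let E : ℕ → ((str K (2 * k + 2)).tensorFunctor ⋙ (str K (2 * k + 1)).tensorFunctor).obj
      (regular K) := fun i =>
    tmul (basisVec K (2 * k + 1) i) (basisVec K (2 * k + 2) (2 * (i / 2)))
  have h0 (i : ℕ) : E (2 * i) =
      tmul (basisVec K (2 * k + 1) (2 * i)) (basisVec K (2 * k + 2) (2 * i)) := by
    simp only [E]; congr 2; omega
  have h1 (i : ℕ) : E (2 * i + 1) =
      tmul (basisVec K (2 * k + 1) (2 * i + 1)) (basisVec K (2 * k + 2) (2 * i)) := by
    simp only [E]; congr 2; omega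
  have hl : ∀ i < 2 * k + 1, strLift (2 * k + 1) E ((str K (2 * k + 1)).lx (basisVec K _ i)) =
      (DualNumber.eps : DualNumber K) • E i := by
    intro i hi
    obtain ⟨a, rfl | rfl⟩ := Nat.even_or_odd' i
    · rw [h0, eps_smul_tmul]
      by_cases ha : 2 * a + 1 < 2 * k + 1
      · rw [lx_basisVec_even ha, strLift_basisVec _ ha, h1]
      · rw [lx_basisVec_of_le (by omega), map_zero, zero_tmul]
    · rw [h1, eps_smul_tmul, lx_basisVec_odd, map_zero, zero_tmul]
  have hr : ∀ i < 2 * k + 1, strLift (2 * k + 1) E ((str K (2 * k + 1)).rx (basisVec K _ i)) =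
      (right _).hom.hom (E i) := by
    intro i hi
    obtain ⟨a, rfl | rfl⟩ := Nat.even_or_odd' i
    · rw [h0, right_tmul]
      obtain _ | a := a
      · rw [mul_zero, rx_basisVec_zero, rx_basisVec_zero, map_zero, tmul_zero]
      -- Balancing: `e (2a+2) ⊗ e (2a+1) = e (2a+2) ⊗ x e (2a) = e (2a+1) ⊗ e (2a)`.
      · rw [show 2 * (a + 1) = 2 * a + 2 by ring, rx_basisVec_even hi, rx_basisVec_even (by omega),
          strLift_basisVec _ (by omega), h1, ← lx_basisVec_even (n := 2 * k + 2) (by omega), tmul_lx,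
          rx_basisVec_even hi]
    · rw [h1, right_tmul, rx_basisVec_odd, map_zero]
      obtain _ | a := a
      · rw [mul_zero, rx_basisVec_zero, tmul_zero]
      · rw [show 2 * (a + 1) = 2 * a + 2 by ring, rx_basisVec_even (by omega),
          ← lx_basisVec_even (n := 2 * k + 2) (by omega), tmul_lx, show 2 * a + 2 + 1 = 2 * (a + 1) + 1 by ring,
          rx_basisVec_odd, zero_tmul]
  refine ⟨⟨strDesc _ E map_point_base hl hr, strMulHom (by omega), ?_⟩⟩
  · apply hom_ext_toLin
    refine str_hom_ext fun i hi => ?_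
    rw [NatTrans.id_app, toLin_id]
    have h2 := strMul_basisVec (K := K) (n := 2 * k + 1) (n' := 2 * k + 2) (i := i) (by omega)
    have h3 := strDesc_basisVec _ E map_point_base hl hr hi
    rw [toLin_comp_app, h3]
    simp only [E]
    rw [strMulHom_tmul, h2]
    exact rid_pure_one _

end Coproduct

end DualBimod

/-! ### Indecomposability in terms of idempotents. -/

namespace DualBimod

section Idempotents

/-- An idempotent splits through its range. The property passes to endofunctors, where
`Indecomposable.idempotent` is applied. -/
instance {R : Type u} [Ring R] : IsIdempotentComplete (FGModuleCat.{u} R) where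
  idempotents_split X p hp := by
    let f : X →ₗ[R] X := p.hom.hom
    have hf (x : X) : f (f x) = f x := congrArg (fun q => q.hom.hom x) hp
    refine ⟨FGModuleCat.of R (LinearMap.range f), FGModuleCat.ofHom (LinearMap.range f).subtype,
      FGModuleCat.ofHom f.rangeRestrict, ?_, ?_⟩
    · apply FGModuleCat.hom_ext
      refine LinearMap.ext fun (y : LinearMap.range f) => ?_
      obtain ⟨x, hx⟩ := y.2
      apply Subtype.ext
      change f y.1 = y.1
      rw [← hx, hf]
    · apply FGModuleCat.hom_ext
      rfl

variable {C : Type*} [Category* C] [Preadditive C] [HasBinaryBiproducts C]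

theorem indecomposable_of_idempotent {X : C} (hX : ¬ IsZero X)
    (h : ∀ e : X ⟶ X, e ≫ e = e → e = 0 ∨ e = 𝟙 X) : Indecomposable X := by
  refine ⟨hX, fun Y Z φ => ?_⟩
  have hfst : φ.hom ≫ biprod.fst ≫ biprod.inl ≫ φ.inv = 0 ∨
      φ.hom ≫ biprod.fst ≫ biprod.inl ≫ φ.inv = 𝟙 X := h _ (by simp)
  rcases hfst with h0 | h1
  · left
    rw [IsZero.iff_id_eq_zero]
    have := congrArg (fun f => (biprod.inl ≫ φ.inv) ≫ f ≫ φ.hom ≫ biprod.fst) h0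
    simpa using this
  · right
    rw [IsZero.iff_id_eq_zero]
    have := congrArg (fun f => (biprod.inr ≫ φ.inv) ≫ f ≫ φ.hom ≫ biprod.snd) h1
    simpa using this.symm

theorem Indecomposable.idempotent [IsIdempotentComplete C] {X : C} (hX : Indecomposable X)
    {e : X ⟶ X} (he : e ≫ e = e) : e = 0 ∨ e = 𝟙 X := by
  obtain ⟨Y, i, r, hir, hri⟩ := IsIdempotentComplete.idempotents_split X e he
  have he' : (𝟙 X - e) ≫ (𝟙 X - e) = 𝟙 X - e := by simp [he]
  obtain ⟨Z, j, s, hjs, hsj⟩ := IsIdempotentComplete.idempotents_split X _ he'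
  have his : i ≫ s = 0 := by
    have h : (i ≫ s) ≫ j = 0 := by
      rw [Category.assoc, hsj, Preadditive.comp_sub, ← hri, Category.comp_id, ← Category.assoc,
        hir, Category.id_comp, sub_self]
    rw [← Category.comp_id (i ≫ s), ← hjs, ← Category.assoc, h, zero_comp]
  have hjr : j ≫ r = 0 := by
    have h : s ≫ (j ≫ r) = 0 := by
      rw [← Category.assoc, hsj, Preadditive.sub_comp, ← hri, Category.id_comp, Category.assoc,
        hir, Category.comp_id, sub_self]
    rw [← Category.id_comp (j ≫ r), ← hjs, Category.assoc, h, comp_zero]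
  let φ : X ≅ Y ⊞ Z :=
    { hom := biprod.lift r s
      inv := biprod.desc i j
      hom_inv_id := by rw [biprod.lift_desc, hri, hsj, add_sub_cancel]
      inv_hom_id := by
        apply biprod.hom_ext <;> apply biprod.hom_ext' <;> simp [hir, hjs, his, hjr] }
  rcases hX.2 Y Z φ with h | h
  · left; rw [← hri, h.eq_of_tgt r 0, zero_comp]
  · right
    have : 𝟙 X - e = 0 := by rw [← hsj, h.eq_of_tgt s 0, zero_comp]
    exact (sub_eq_zero.mp this).symm

end Idempotents

variable {K : Type u} [Field K]

open Bimodule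

/-! ### Fitting's lemma for bimodules. -/

section Fitting

variable {U : Bimodule K}

/-- A bimodule endomorphism of an indecomposable bimodule with a nonzero fixed vector is
bijective. -/
theorem bijective_of_fixed (hU : Indecomposable U.tensorFunctor) (φ : Module.End K U.carrier)
    (hl : ∀ u, φ (U.lx u) = U.lx (φ u)) (hr : ∀ u, φ (U.rx u) = U.rx (φ u))
    {v : U.carrier} (hv : φ v = v) (hv0 : v ≠ 0) : Function.Bijective φ := by
  obtain ⟨n, hn⟩ := Filter.eventually_atTop.mp φ.eventually_isCompl_ker_pow_range_pow
  -- The exponent is kept positive so that `ker φ` lies in the kernel of the power.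
  have hc := (hn (n + 1) (by omega)).symm
  have comm_pow (f : Module.End K U.carrier) (hf : ∀ u, φ (f u) = f (φ u)) (m : ℕ) (u) :
      (φ ^ m) (f u) = f ((φ ^ m) u) := by
    have : Commute φ f := LinearMap.ext hf
    exact LinearMap.congr_fun (this.pow_left m) u
  -- The Fitting projection commutes with whatever commutes with `φ`, so it is an idempotent
  -- bimodule map. It is not zero, because the fixed vector lies in the range.
  set p := (LinearMap.range (φ ^ (n + 1))).projection (LinearMap.ker (φ ^ (n + 1))) hc with hp
  have comm_p (f : Module.End K U.carrier) (hf : ∀ u, φ (f u) = f (φ u)) (u) :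
      p (f u) = f (p u) := by
    have h1 : f (p u) ∈ LinearMap.range (φ ^ (n + 1)) := by
      obtain ⟨w, hw⟩ := Submodule.projection_apply_mem hc u
      exact ⟨f w, by rw [comm_pow f hf, hw]⟩
    have h2 : f (u - p u) ∈ LinearMap.ker (φ ^ (n + 1)) := by
      have : u - p u ∈ LinearMap.ker (φ ^ (n + 1)) := Submodule.sub_projection_mem hc u
      rw [LinearMap.mem_ker] at this ⊢
      rw [comm_pow f hf, this, map_zero]
    have h3 : f u = f (p u) + f (u - p u) := by rw [← map_add, add_sub_cancel]
    rw [h3, map_add, hp, Submodule.projection_apply_of_mem_left hc h1,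
      (Submodule.projection_apply_eq_zero_iff hc).mpr h2, add_zero]
  let τ := mapHom p (comm_p _ hl) (comm_p _ hr)
  have hpp (u) : p (p u) = p u :=
    Submodule.projection_apply_of_mem_left hc (Submodule.projection_apply_mem hc u)
  have hτ : τ ≫ τ = τ := hom_ext_toLin (by
    rw [NatTrans.comp_app, toLin_comp, toLin_mapHom]
    exact LinearMap.ext hpp)
  have hker : LinearMap.ker (φ ^ (n + 1)) = ⊥ := by
    rcases Indecomposable.idempotent hU hτ with h | h
    · have h1 : p = 0 := by
        rw [← toLin_mapHom p (comm_p _ hl) (comm_p _ hr)]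
        refine (congrArg (fun σ => toLin (σ.app (regular K))) h).trans toLin_zero
      have h2 : ∀ m, (φ ^ m) v = v := by
        intro m
        induction m with
        | zero => rfl
        | succ m ih => rw [pow_succ, Module.End.mul_apply, hv, ih]
      have h3 : p v = v := Submodule.projection_apply_of_mem_left hc ⟨v, h2 _⟩
      rw [h1, LinearMap.zero_apply] at h3
      exact absurd h3.symm hv0
    · have h1 : p = LinearMap.id := by
        rw [← toLin_mapHom p (comm_p _ hl) (comm_p _ hr)]
        refine (congrArg (fun σ => toLin (σ.app (regular K))) h).trans toLin_id
      rw [← Submodule.ker_projection hc, ← hp, h1, LinearMap.ker_id]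
  have hinj : Function.Injective φ := by
    rw [← LinearMap.ker_eq_bot, eq_bot_iff]
    intro u hu
    rw [← hker, LinearMap.mem_ker, pow_succ, Module.End.mul_apply, LinearMap.mem_ker.mp hu, map_zero]
  exact ⟨hinj, LinearMap.injective_iff_surjective.mp hinj⟩

end Fitting

/-! ### Strings are indecomposable. -/

section StringIndecomposable

variable {n : ℕ} {e : Module.End K (str K n).carrier}

/-- The vectors `x e (2a)` and `e (2a+2) x` coincide, so comparing images makes the top-to-top
matrix constant along diagonals. Two maps `e`, `e'` are allowed so that this applies to consecutive
members of a chain. -/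
theorem co_shift (hl : ∀ u, e ((str K n).lx u) = (str K n).lx (e u))
    {e' : Module.End K (str K n).carrier}
    (hr : ∀ u, e ((str K n).rx u) = (str K n).rx (e' u)) {a c : ℕ} (ha : 2 * a + 2 < n)
    (hc : 2 * c + 1 < n) : co n (2 * c) (e (basisVec K n (2 * a))) =
      co n (2 * (c + 1)) (e' (basisVec K n (2 * (a + 1)))) := by
  have h : (str K n).lx (e (basisVec K n (2 * a))) =
      (str K n).rx (e' (basisVec K n (2 * (a + 1)))) := by
    rw [← hl, ← hr, lx_basisVec_even (by omega), mul_add, mul_one, rx_basisVec_even ha]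
  have h' := congrArg (co n (2 * c + 1)) h
  rwa [co_lx_odd, co_rx_odd, if_pos hc] at h'

/-- Slide the entry along its diagonal to the column of `e 0`. Since `e 0 · x = 0`, that column
vanishes off its first entry, which is zero by assumption. -/
theorem co_even_even (hl : ∀ u, e ((str K n).lx u) = (str K n).lx (e u))
    (hr : ∀ u, e ((str K n).rx u) = (str K n).rx (e u)) (h0 : co n 0 (e (basisVec K n 0)) = 0) (a c : ℕ) (hac : a ≤ c) :
    co n (2 * c) (e (basisVec K n (2 * a))) = 0 := by
  by_cases hc : n ≤ 2 * c
  · exact co_of_le hc _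
  induction a generalizing c with
  | zero =>
    obtain _ | c := c
    · exact h0
    · rw [mul_add, mul_one, ← co_rx_odd, ← hr, mul_zero, rx_basisVec_zero, map_zero, map_zero]
  | succ a ih =>
    obtain _ | c := c
    · omega
    · rw [← co_shift hl hr (by omega) (by omega)]
      exact ih c (by omega) (by omega)

/-- A bimodule endomorphism of a string whose leading coefficient vanishes has no nonzero fixed
vector. -/
theorem eq_zero_of_fixed (hl : ∀ u, e ((str K n).lx u) = (str K n).lx (e u))
    (hr : ∀ u, e ((str K n).rx u) = (str K n).rx (e u)) (h0 : co n 0 (e (basisVec K n 0)) = 0) {v : (str K n).carrier}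
    (hv : e v = v) : v = 0 := by
  have hsum (j : ℕ) : co n j v =
      ∑ i ∈ Finset.range n, co n i v * co n j (e (basisVec K n i)) := by
    conv_lhs => rw [← hv, eq_sum_basisVec v]
    simp only [map_sum, map_smul, smul_eq_mul]
  have hodd {a : ℕ} (ha : 2 * a + 1 < n) : e (basisVec K n (2 * a + 1)) =
      (str K n).lx (e (basisVec K n (2 * a))) := by
    rw [← hl, lx_basisVec_even ha]
  -- Descending induction on `c`: by strict triangularity, coordinate `2c` of `v = e v` involves
  -- only the coordinates `2a` with `a > c`.
  have heven : ∀ d c : ℕ, n ≤ c + d → co n (2 * c) v = 0 := by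
    intro d
    induction d with
    | zero => exact fun c hc => co_of_le (by omega) v
    | succ d ih =>
      intro c hc
      rw [hsum]
      refine Finset.sum_eq_zero fun i hi => ?_
      obtain ⟨a, rfl | rfl⟩ := Nat.even_or_odd' i
      · rcases le_or_gt a c with h | h
        · rw [co_even_even hl hr h0 a c h, mul_zero]
        · rw [ih a (by omega), zero_mul]
      · rw [hodd (Finset.mem_range.mp hi), co_lx_even, mul_zero]
  have hodd' : ∀ d c : ℕ, n ≤ c + d → co n (2 * c + 1) v = 0 := by
    intro d
    induction d with
    | zero => exact fun c hc => co_of_le (by omega) v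
    | succ d ih =>
      intro c hc
      rw [hsum]
      refine Finset.sum_eq_zero fun i hi => ?_
      obtain ⟨a, rfl | rfl⟩ := Nat.even_or_odd' i
      · rw [heven n a (by omega), zero_mul]
      · rcases le_or_gt a c with h | h
        · rw [hodd (Finset.mem_range.mp hi), co_lx_odd, co_even_even hl hr h0 a c h, ite_self,
            mul_zero]
        · rw [ih a (by omega), zero_mul]
  refine co_ext_parity (fun i => ?_) (fun i => ?_)
  · rw [heven n i (by omega), map_zero]
  · rw [hodd' n i (by omega), map_zero]

theorem str_idempotent {τ : (str K n).tensorFunctor ⟶ (str K n).tensorFunctor}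
    (h : τ ≫ τ = τ) : τ = 0 ∨ τ = 𝟙 _ := by
  have hl := toLin_lx (τ.app (regular K))
  have hr := toLin_app_rx τ
  have hid : ∀ u, toLin (τ.app (regular K)) (toLin (τ.app (regular K)) u) =
      toLin (τ.app (regular K)) u := by
    intro u
    have := congrArg (fun σ => toLin (σ.app (regular K))) h
    simp only [NatTrans.comp_app, toLin_comp] at this
    exact LinearMap.congr_fun this u
  set e := toLin (τ.app (regular K)) with he
  rcases eq_or_ne (co n 0 (e (basisVec K n 0))) 0 with h0 | h0
  · left
    apply hom_ext_toLin
    refine .trans ?_ toLin_zero.symm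
    rw [← he]
    exact LinearMap.ext fun u => eq_zero_of_fixed hl hr h0 (hid u)
  · right
    set c := co n 0 (e (basisVec K n 0)) with hc
    apply hom_ext_toLin
    rw [NatTrans.id_app, toLin_id, ← he]
    refine LinearMap.ext fun u => (sub_eq_zero.mp ?_).symm
    have hn : 0 < n := by
      by_contra hn
      exact h0 (co_of_le (by omega) _)
    -- `1 - c⁻¹ e` has leading coefficient zero, and it fixes `u - e u` because the idempotent `e`
    -- kills that vector.
    refine eq_zero_of_fixed (e := LinearMap.id - c⁻¹ • e) (fun v => ?_) (fun v => ?_) ?_ ?_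
    · simp [hl]
    · simp [hr]
    · simp [co_basisVec, ← hc, h0, hn]
    · simp [hid]

theorem indecomposable_str (hn : 0 < n) : Indecomposable (str K n).tensorFunctor := by
  refine indecomposable_of_idempotent (fun h => ?_) fun τ => str_idempotent
  have h1 := congrArg (fun σ => toLin (σ.app (regular K))) (h.eq_of_src (𝟙 _) 0)
  simp only [NatTrans.id_app, toLin_id] at h1
  have h2 := congrArg (co n 0) (LinearMap.congr_fun (h1.trans toLin_zero) (basisVec K n 0))
  simp [co_basisVec, hn] at h2

end StringIndecomposable

end DualBimod

/-! ### Chains and their transfer to direct summands. -/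

namespace DualBimod

variable {K : Type u} [Field K]

open Bimodule

/-- A sequence of endomorphisms of the left module `F(D)`, supported on `0, …, k`, that is shifted
by the right action. -/
structure IsChain (F : EndoD K) (k : ℕ) (f : ℕ → (F.obj (regular K) ⟶ F.obj (regular K))) :
    Prop where
  zero : f 0 ≫ right F = 0
  shift : ∀ i, right F ≫ f i = f (i + 1) ≫ right F
  bound : ∀ i, k < i → f i = 0

/-- A chain whose members add up to the identity. -/
structure IsUnitChain (F : EndoD K) (k : ℕ) (f : ℕ → (F.obj (regular K) ⟶ F.obj (regular K))) :
    Prop extends IsChain F k f where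
  sum : ∑ i ∈ Finset.range (k + 1), f i = 𝟙 _

section Transfer

variable {F G A : EndoD K} {k : ℕ} {f : ℕ → (F.obj (regular K) ⟶ F.obj (regular K))}

theorem IsChain.mono (hf : IsChain F k f) {k' : ℕ} (h : k ≤ k') : IsChain F k' f :=
  ⟨hf.zero, hf.shift, fun i hi => hf.bound i (by omega)⟩

theorem IsUnitChain.mono (hf : IsUnitChain F k f) {k' : ℕ} (h : k ≤ k') : IsUnitChain F k' f where
  toIsChain := hf.toIsChain.mono h
  sum := by
    rw [← hf.sum]
    refine (Finset.sum_subset (Finset.range_mono (by omega)) fun i _ hi => ?_).symm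
    exact hf.bound i (by simpa using hi)

/-- The endomorphism of `G(D)` induced by an endomorphism of `F(D)` if `G` is a direct summand of
`A ∘ F`. -/
noncomputable def transfer (r : Retract G (F ⋙ A)) :
    (F.obj (regular K) ⟶ F.obj (regular K)) → (G.obj (regular K) ⟶ G.obj (regular K)) :=
  fun h => r.i.app (regular K) ≫ A.map h ≫ r.r.app (regular K)

variable (r : Retract G (F ⋙ A))

theorem right_comp_i : right G ≫ r.i.app (regular K) = r.i.app (regular K) ≫ A.map (right F) :=
  r.i.naturality _

theorem map_right_comp_r :
    A.map (right F) ≫ r.r.app (regular K) = r.r.app (regular K) ≫ right G :=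
  r.r.naturality _

theorem transfer_id : transfer r (𝟙 _) = 𝟙 _ := by
  rw [transfer, A.map_id]
  exact congrArg (fun τ => τ.app (regular K)) r.retract

variable [A.Additive]

theorem transfer_zero : transfer r 0 = 0 := by
  rw [transfer, A.map_zero, zero_comp, comp_zero]

theorem transfer_sum {ι : Type*} (s : Finset ι)
    (h : ι → (F.obj (regular K) ⟶ F.obj (regular K))) :
    transfer r (∑ i ∈ s, h i) = ∑ i ∈ s, transfer r (h i) := by
  simp only [transfer, A.map_sum, Preadditive.sum_comp, Preadditive.comp_sum]

/-- Naturality moves right multiplication through `r.i` and `r.r`. The conditions are linear in `f`,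
so they survive the compression although it does not respect composition. -/
theorem IsChain.transfer (hf : IsChain F k f) : IsChain G k fun i => transfer r (f i) where
  zero := by
    simp only [DualBimod.transfer, Category.assoc]
    rw [← map_right_comp_r, ← A.map_comp_assoc, hf.zero, A.map_zero, zero_comp, comp_zero]
  shift i := by
    simp only [DualBimod.transfer, Category.assoc]
    rw [← map_right_comp_r, ← Category.assoc, right_comp_i, Category.assoc, ← A.map_comp_assoc,
      ← A.map_comp_assoc, hf.shift]
  bound i hi := by rw [hf.bound i hi, transfer_zero]

theorem IsUnitChain.transfer (hf : IsUnitChain F k f) :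
    IsUnitChain G k fun i => DualBimod.transfer r (f i) where
  toIsChain := hf.toIsChain.transfer r
  sum := by rw [← transfer_sum, hf.sum, transfer_id]

end Transfer

/-! ### The block projections of a string as a unit chain. -/

section StringChains

variable (n : ℕ)

/-- The projection of a string onto the span of `e (2i)` and `e (2i+1)`. -/
noncomputable def strProj (i : ℕ) : Module.End K (str K n).carrier where
  toFun v := ofCo n fun j => if j / 2 = i then co n j v else 0
  map_add' v w := co_ext fun j => by
    rw [map_add]; simp only [co_ofCo, map_add]; split_ifs <;> ring
  map_smul' c v := co_ext fun j => by
    rw [map_smul]; simp only [co_ofCo, map_smul, RingHom.id_apply, smul_eq_mul]; split_ifs <;> ring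

variable {n}

theorem co_strProj (i j : ℕ) (v : (str K n).carrier) :
    co n j (strProj n i v) = if j / 2 = i then co n j v else 0 := by
  simp only [strProj, LinearMap.coe_mk, AddHom.coe_mk, co_ofCo]
  split_ifs with h h' h'
  · rfl
  · rfl
  · rw [co_of_le (by omega)]
  · rfl

theorem strProj_lx (i : ℕ) (v : (str K n).carrier) :
    strProj n i ((str K n).lx v) = (str K n).lx (strProj n i v) := by
  refine co_ext_parity (fun a => ?_) (fun a => ?_)
  · rw [co_strProj, co_lx_even, co_lx_even, ite_self]
  · rw [co_strProj, co_lx_odd, co_lx_odd, co_strProj]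
    have h1 : (2 * a + 1) / 2 = a := by omega
    have h2 : 2 * a / 2 = a := by omega
    rw [h1, h2]
    split_ifs <;> rfl

/-- Right multiplication takes `e (2i+2)` to `e (2i+1)`, lowering the block index by one. This is
the model for `IsChain.shift`. -/
theorem strProj_rx (i : ℕ) (v : (str K n).carrier) :
    strProj n i ((str K n).rx v) = (str K n).rx (strProj n (i + 1) v) := by
  refine co_ext_parity (fun a => ?_) (fun a => ?_)
  · rw [co_strProj, co_rx_even, co_rx_even, ite_self]
  · rw [co_strProj, co_rx_odd, co_rx_odd, co_strProj]
    have h1 : (2 * a + 1) / 2 = a := by omega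
    have h2 : (2 * a + 2) / 2 = a + 1 := by omega
    rw [h1, h2]
    simp

theorem isUnitChain_strProj {k : ℕ} (h : n ≤ 2 * k + 2) :
    IsUnitChain (str K n).tensorFunctor k fun i => ofLin (strProj n i) (strProj_lx i) where
  zero := by
    apply toLin_injective
    rw [toLin_comp, toLin_ofLin, toLin_right, toLin_zero]
    refine LinearMap.ext fun v => co_ext_parity (fun a => ?_) (fun a => ?_)
    · rw [LinearMap.comp_apply, co_rx_even, LinearMap.zero_apply, map_zero]
    · rw [LinearMap.comp_apply, co_rx_odd, co_strProj, if_neg (by omega), LinearMap.zero_apply,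
        map_zero]
  shift i := by
    apply toLin_injective
    rw [toLin_comp, toLin_comp, toLin_ofLin, toLin_ofLin, toLin_right]
    exact LinearMap.ext fun v => strProj_rx i v
  bound i hi := by
    apply toLin_injective
    rw [toLin_ofLin, toLin_zero]
    refine LinearMap.ext fun v => co_ext fun j => ?_
    rw [co_strProj, LinearMap.zero_apply, map_zero]
    split_ifs with hj
    · exact co_of_le (by omega) v
    · rfl
  sum := by
    apply toLin_injective
    have hsum (s : Finset ℕ) : toLin (∑ i ∈ s, ofLin (strProj (K := K) n i) (strProj_lx i)) =
        ∑ i ∈ s, strProj n i := by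
      induction s using Finset.induction_on with
      | empty => simp only [Finset.sum_empty]; exact toLin_zero
      | insert a s ha ih => rw [Finset.sum_insert ha, Finset.sum_insert ha, toLin_add, ih, toLin_ofLin]
    rw [hsum, toLin_id]
    refine LinearMap.ext fun v => co_ext fun j => ?_
    rw [LinearMap.sum_apply, map_sum, LinearMap.id_apply]
    simp only [co_strProj]
    by_cases hj : j < n
    · rw [Finset.sum_ite_eq, if_pos (by rw [Finset.mem_range]; omega)]
    · simp [co_of_le (not_lt.mp hj)]

end StringChains

/-! ### Leading coefficients of chains on `W_k`. -/

section Leading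

variable {k : ℕ}

variable (k) in
/-- The leading coefficient of an endomorphism of the left module `W_k`. -/
noncomputable def lead (h : (str K (2 * k + 1)).tensorFunctor.obj (regular K) ⟶
    (str K (2 * k + 1)).tensorFunctor.obj (regular K)) : K :=
  co (2 * k + 1) 0 (toLin h (basisVec K (2 * k + 1) 0))

theorem lead_zero : lead (K := K) k 0 = 0 := by
  rw [lead, toLin_zero, LinearMap.zero_apply, map_zero]

theorem lead_id : lead (K := K) k (𝟙 _) = 1 := by
  rw [lead, toLin_id, LinearMap.id_apply, co_basisVec, if_pos (by omega)]

theorem lead_sum (s : Finset ℕ) (h : ℕ → ((str K (2 * k + 1)).tensorFunctor.obj (regular K) ⟶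
    (str K (2 * k + 1)).tensorFunctor.obj (regular K))) :
    lead k (∑ i ∈ s, h i) = ∑ i ∈ s, lead k (h i) := by
  induction s using Finset.induction_on with
  | empty => exact lead_zero
  | insert a s ha ih =>
    rw [Finset.sum_insert ha, Finset.sum_insert ha, ← ih, lead, toLin_add, LinearMap.add_apply,
      map_add]
    rfl

variable {h : ℕ → ((str K (2 * k + 1)).tensorFunctor.obj (regular K) ⟶
    (str K (2 * k + 1)).tensorFunctor.obj (regular K))}

/-- Each application of `co_shift` moves one step down the diagonal and from one chain member to the
next. At `a = k` only `h (i + k)` matters, and it vanishes for `i > 0`. -/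
theorem IsChain.lead_eq (hh : IsChain (str K (2 * k + 1)).tensorFunctor k h) (i a : ℕ)
    (ha : a ≤ k) : lead k (h i) = co (2 * k + 1) (2 * a)
      (toLin (h (i + a)) (basisVec K (2 * k + 1) (2 * a))) := by
  induction a with
  | zero => rfl
  | succ a ih =>
    rw [ih (by omega)]
    refine co_shift (toLin_lx _) (fun u => ?_) (by omega) (by omega)
    have h1 := congrArg (fun q => toLin q u) (hh.shift (i + a))
    simp only [toLin_comp, toLin_right] at h1
    exact h1

theorem IsChain.lead_eq_zero (hh : IsChain (str K (2 * k + 1)).tensorFunctor k h)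
    (hk : h k = 0) (i : ℕ) : lead k (h i) = 0 := by
  rw [hh.lead_eq i k le_rfl]
  obtain _ | i := i
  · rw [zero_add, hk, toLin_zero, LinearMap.zero_apply, map_zero]
  · rw [hh.bound _ (by omega), toLin_zero, LinearMap.zero_apply, map_zero]

theorem IsUnitChain.lead_eq_one (hh : IsUnitChain (str K (2 * k + 1)).tensorFunctor k h) :
    lead k (h 0) = 1 := by
  rw [← lead_id, ← hh.sum, lead_sum, Finset.sum_range_succ', Finset.sum_eq_zero, zero_add]
  intro i _
  rw [hh.lead_eq _ k le_rfl, hh.bound _ (by omega), toLin_zero, LinearMap.zero_apply, map_zero]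

/-- There are no short unit chains on a functor `F` such that `W_k` is a direct summand of some
`A ∘ F`. -/
theorem IsUnitChain.le_of_retract {F A : EndoD K} [A.Additive]
    (r : Retract (str K (2 * k + 1)).tensorFunctor (F ⋙ A)) {j : ℕ}
    {f : ℕ → (F.obj (regular K) ⟶ F.obj (regular K))} (hf : IsUnitChain F j f) : k ≤ j := by
  by_contra hjk
  have h := (hf.mono (by omega : j ≤ k)).transfer r
  have h1 := h.lead_eq_one
  rw [h.lead_eq_zero (by rw [hf.bound k (by omega), transfer_zero])] at h1
  exact zero_ne_one h1

/-- If `W_k` is a direct summand of `Y ∘ U`, then the square of the first member of a unit chain on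
`U` is not a multiple of the right action. -/
theorem IsUnitChain.exists_notMem_range {U Y : Bimodule K}
    (r : Retract (str K (2 * k + 1)).tensorFunctor (U.tensorFunctor ⋙ Y.tensorFunctor))
    {f : ℕ → (U.tensorFunctor.obj (regular K) ⟶ U.tensorFunctor.obj (regular K))}
    (hf : IsUnitChain U.tensorFunctor k f) :
    ∃ u, ∀ w, toLin (f 0) (toLin (f 0) u) ≠ U.rx w := by
  by_contra! hcon
  have h1 := (hf.transfer r).lead_eq_one
  -- Expanding the identity shows that the leading coefficient `1` comes entirely from `f 0 ≫ f 0`,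
  -- once the other terms are shown to contribute zero.
  have h2 : f 0 = ∑ i ∈ Finset.range (k + 1), f i ≫ f 0 := by
    rw [← Preadditive.sum_comp, hf.sum, Category.id_comp]
  have h3 (m : ℕ) (hm : 0 < m) : lead k (DualBimod.transfer r (f m ≫ f 0)) = 0 := by
    -- These products again form a chain; its `k`-th member is zero because `k + m > k`, so all its
    -- leading coefficients vanish.
    have hc : IsChain U.tensorFunctor k fun i => f (i + m) ≫ f i :=
      { zero := by rw [Category.assoc, hf.zero, comp_zero]
        shift := fun i => by
          rw [← Category.assoc, hf.shift, Category.assoc, hf.shift, Category.assoc]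
          congr 2
          omega
        bound := fun i hi => by rw [hf.bound i hi, comp_zero] }
    have := (hc.transfer r).lead_eq_zero
      (by rw [hf.bound (k + m) (by omega), zero_comp, transfer_zero]) 0
    simpa using this
  have h4 : lead k (DualBimod.transfer r (f 0 ≫ f 0)) = 1 := by
    rw [← h1]
    conv_rhs => rw [h2]
    rw [transfer_sum, lead_sum, Finset.sum_range_succ', Finset.sum_eq_zero, zero_add]
    exact fun i _ => h3 _ (by omega)
  -- If `f 0 ≫ f 0` has image in `Ux`, its transfer has image in `W_k x`, where top coordinates are
  -- zero. This contradicts the leading coefficient `1`.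
  have h5 (x : (U.tensorFunctor ⋙ Y.tensorFunctor).obj (regular K)) :
      ∃ x', (Y.tensorFunctor.map (f 0 ≫ f 0)).hom.hom x =
        (Y.tensorFunctor.map (right U.tensorFunctor)).hom.hom x' := by
    induction x using comp_tensor_induction with
    | hz => exact ⟨0, by rw [map_zero, map_zero]⟩
    | h y u =>
      obtain ⟨w, hw⟩ := hcon u
      refine ⟨tmul y w, .trans ?_ (right_tmul y w).symm⟩
      rw [← hw]
      have : (f 0 ≫ f 0).hom.hom (U.pure u (1 : DualNumber K)) =
          U.pure (toLin (f 0) (toLin (f 0) u)) (1 : DualNumber K) := by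
        rw [pure_toLin, pure_toLin]; rfl
      exact congrArg (Y.pure y) this
    | ha s t hs ht =>
      obtain ⟨s', hs⟩ := hs
      obtain ⟨t', ht⟩ := ht
      exact ⟨s' + t', by rw [map_add, map_add, hs, ht]⟩
  obtain ⟨x', hx'⟩ := h5 ((r.i.app (regular K)).hom.hom
    ((str K (2 * k + 1)).pure (basisVec K _ 0) (1 : DualNumber K)))
  have h6 : toLin (DualBimod.transfer r (f 0 ≫ f 0)) (basisVec K (2 * k + 1) 0) =
      (str K (2 * k + 1)).rx (rid _ ((r.r.app (regular K)).hom.hom x')) := by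
    have h7 := congrArg (fun q => q.hom.hom x') (map_right_comp_r r)
    have h8 := LinearMap.congr_fun (toLin_right (U := str K (2 * k + 1)))
      (rid _ ((r.r.app (regular K)).hom.hom x'))
    rw [← h8]
    refine (congrArg (fun t => rid _ ((r.r.app (regular K)).hom.hom t)) hx').trans ?_
    refine (congrArg (rid _) h7).trans ?_
    exact congrArg (fun t : (str K (2 * k + 1)).Tensor (DualNumber K) => (str K (2 * k + 1)).rid
      ((right (str K (2 * k + 1)).tensorFunctor).hom.hom t)) (pure_rid _).symm
  rw [lead, h6] at h4
  have h9 := co_rx_even 0 (rid _ ((r.r.app (regular K)).hom.hom x'))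
  rw [mul_zero] at h9
  rw [h9] at h4
  exact zero_ne_one h4

end Leading

end DualBimod

/-! ### Linear duality, and recognising an indecomposable bimodule as a string. -/

namespace DualBimod

variable {K : Type u} [Field K]

open Bimodule

section Linear

variable {V : Type u} [AddCommGroup V] [Module K V]

theorem exists_dual_eq_one {p : Submodule K V} {v : V} (hv : v ∉ p) :
    ∃ f : V →ₗ[K] K, f v = 1 ∧ ∀ w ∈ p, f w = 0 := by
  obtain ⟨f, hf, hp⟩ := Submodule.exists_le_ker_of_notMem hv
  refine ⟨(f v)⁻¹ • f, by simp [hf], fun w hw => ?_⟩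
  have := hp hw
  rw [LinearMap.mem_ker] at this
  simp [this]

/-- If the vector `L g` cannot be continued to a chain, this is witnessed by a chain of linear
functionals. -/
theorem exists_dual_chain (L R : Module.End K V) {N M : ℕ} (hN : 0 < N) (hMN : M ≤ N + 1) (g : V)
    (hno : ¬ ∃ h : ℕ → V, h 0 = g ∧ ∀ a < N, L (h a) = if a + 1 < M then R (h (a + 1)) else 0) :
    ∃ β : ℕ → (V →ₗ[K] K), β 0 (L g) = 1 ∧
      ∀ b, b + 1 < M → ∀ u, β b (R u) = if b + 1 < N then β (b + 1) (L u) else 0 := by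
  -- With `h 0 = g` moved to the other side, continuing the chain means solving `Ψ h = (L g, 0, …,
  -- 0)`. A functional separating the right side from the range of `Ψ` has components `β`.
  let Ψ : (ℕ → V) →ₗ[K] (Fin N → V) := LinearMap.pi fun a =>
    (if a.1 + 1 < M then R ∘ₗ LinearMap.proj (a.1 + 1) else 0) -
      (if a.1 = 0 then 0 else L ∘ₗ LinearMap.proj a.1)
  have hΨ (h : ℕ → V) (a : Fin N) : Ψ h a =
      (if a.1 + 1 < M then R (h (a.1 + 1)) else 0) - (if a.1 = 0 then 0 else L (h a.1)) := by
    simp only [Ψ, LinearMap.pi_apply, LinearMap.sub_apply]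
    split_ifs <;> rfl
  have hmem : (Pi.single ⟨0, hN⟩ (L g) : Fin N → V) ∉ LinearMap.range Ψ := by
    rintro ⟨h, hh⟩
    refine hno ⟨fun a => if a = 0 then g else h a, rfl, fun a ha => ?_⟩
    have := congrFun hh ⟨a, ha⟩
    rw [hΨ] at this
    obtain _ | a := a
    · simp only [Pi.single_eq_same, if_true, sub_zero] at this
      simpa using this.symm
    · rw [Pi.single_eq_of_ne (by simp)] at this
      simpa using (sub_eq_zero.mp this).symm
  obtain ⟨f, hf1, hf0⟩ := exists_dual_eq_one hmem
  refine ⟨fun a => if h : a < N then f ∘ₗ LinearMap.single K (fun _ => V) ⟨a, h⟩ else 0, ?_, ?_⟩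
  · simpa [hN] using hf1
  · intro b hb u
    -- Only the equations numbered `b` and `b + 1` involve the unknown `h (b + 1)`.
    have h1 := hf0 (Ψ (Pi.single (b + 1) u)) ⟨_, rfl⟩
    have h2 : Ψ (Pi.single (b + 1) u) =
        (if h : b < N then Pi.single ⟨b, h⟩ (R u) else 0) -
          (if h : b + 1 < N then Pi.single ⟨b + 1, h⟩ (L u) else 0) := by
      funext a
      rw [hΨ, Pi.sub_apply]
      congr 1
      · by_cases hab : a.1 = b
        · have : b < N := hab ▸ a.2
          have ha : a = ⟨b, this⟩ := Fin.ext hab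
          subst ha
          rw [dif_pos this]
          simp [hb]
        · rw [Pi.single_eq_of_ne (by omega), map_zero, ite_self]
          split_ifs
          · rw [Pi.single_eq_of_ne (fun h => hab (congrArg Fin.val h))]
          · rfl
      · by_cases hab : a.1 = b + 1
        · have : b + 1 < N := hab ▸ a.2
          have ha : a = ⟨b + 1, this⟩ := Fin.ext hab
          subst ha
          simp [this]
        · rw [Pi.single_eq_of_ne hab, map_zero, ite_self]
          split_ifs
          · rw [Pi.single_eq_of_ne (fun h => hab (congrArg Fin.val h))]
          · rfl
    have hbN : b < N := by omega
    rw [h2, map_sub, sub_eq_zero, dif_pos hbN] at h1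
    simp only [hbN, dif_pos, LinearMap.comp_apply]
    refine h1.trans ?_
    split_ifs <;> simp

end Linear

variable {U : Bimodule K}

/-- An indecomposable bimodule with `x U x ≠ 0` is free: the kernel of the right action is
contained in its image. -/
theorem exists_rx_eq_of_lx_rx_ne_zero (hU : Indecomposable U.tensorFunctor) {v : U.carrier}
    (hv : U.lx (U.rx v) ≠ 0) {u : U.carrier} (hu : U.rx u = 0) : ∃ w, u = U.rx w := by
  obtain ⟨f, hf, -⟩ := exists_dual_eq_one (p := (⊥ : Submodule K U.carrier)) (v := U.lx (U.rx v))
    (by simpa using hv)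
  -- This is a composite `U → D ⊗_K D → U`: the first map is the one induced by the functional `f`,
  -- the second sends `1 ⊗ 1` to `v`. It fixes `xvx`, so Fitting makes it bijective.
  let e : Module.End K U.carrier := (f ∘ₗ U.lx ∘ₗ U.rx).smulRight v +
    (f ∘ₗ U.rx).smulRight (U.lx v) + (f ∘ₗ U.lx).smulRight (U.rx v) +
      f.smulRight (U.lx (U.rx v))
  have he (w) : e w = f (U.lx (U.rx w)) • v + f (U.rx w) • U.lx v + f (U.lx w) • U.rx v +
    f w • U.lx (U.rx v) := rfl
  have hb := bijective_of_fixed hU e (fun w => by simp [he, lx_lx, rx_lx])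
    (fun w => by simp [he, rx_rx, rx_lx]) (v := U.lx (U.rx v))
    (by simp [he, lx_lx, rx_lx, rx_rx, hf]) hv
  obtain ⟨w, rfl⟩ := hb.2 u
  rw [he] at hu ⊢
  simp only [map_add, map_smul, rx_rx, rx_lx, smul_zero, add_zero, map_zero] at hu
  have h1 : f (U.lx (U.rx w)) = 0 := by
    have := congrArg (fun z => f (U.lx z)) hu
    simpa [lx_lx, hf] using this
  have h2 : f (U.rx w) = 0 := by
    have := congrArg f hu
    simpa [h1, hf] using this
  exact ⟨f (U.lx w) • v + f w • U.lx v, by simp [h1, h2, rx_lx]⟩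

/-- The partial map `e 0 ↦ g` extends to a homomorphism from the string of length `n` to `U`. -/
def Extends (U : Bimodule K) (n : ℕ) (g : U.carrier) : Prop :=
  ∃ c : ℕ → U.carrier, c 0 = g ∧ U.rx (c 0) = 0 ∧
    (∀ i, 2 * i + 2 < n → U.lx (c i) = U.rx (c (i + 1))) ∧ ∀ i, 2 * i + 1 = n → U.lx (c i) = 0

theorem Extends.exists_hom (hLR : ∀ u, U.lx (U.rx u) = 0) {n : ℕ} (hn : 1 < n) {g : U.carrier}
    (hg : Extends U n g) : ∃ σ : (str K n).carrier →ₗ[K] U.carrier,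
      (∀ v, σ ((str K n).lx v) = U.lx (σ v)) ∧ (∀ v, σ ((str K n).rx v) = U.rx (σ v)) ∧
      σ (basisVec K n 1) = U.lx g := by
  obtain ⟨c, rfl, h0, hc, hcn⟩ := hg
  let C : ℕ → U.carrier := fun j => if Even j then c (j / 2) else U.lx (c (j / 2))
  have hC0 (i : ℕ) : C (2 * i) = c i := by simp [C]
  have hC1 (i : ℕ) : C (2 * i + 1) = U.lx (c i) := by
    have h : (2 * i + 1) / 2 = i := by omega
    simp [C, h]
  let σ : (str K n).carrier →ₗ[K] U.carrier :=
    ∑ j ∈ Finset.range n, (co n j).smulRight (C j)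
  have hσ (j : ℕ) (hj : j < n) : σ (basisVec K n j) = C j := by
    simp only [σ, LinearMap.sum_apply, LinearMap.smulRight_apply, co_basisVec]
    rw [Finset.sum_eq_single j]
    · simp [hj]
    · intro i _ hi; simp [hi]
    · simp [hj]
  refine ⟨σ, fun v => ?_, fun v => ?_, ?_⟩
  · refine LinearMap.congr_fun (f := σ ∘ₗ (str K n).lx) (g := U.lx ∘ₗ σ)
      (str_hom_ext fun j hj => ?_) v
    simp only [LinearMap.comp_apply]
    obtain ⟨i, rfl | rfl⟩ := Nat.even_or_odd' j
    · rw [hσ _ hj, hC0]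
      by_cases h : 2 * i + 1 < n
      · rw [lx_basisVec_even h, hσ _ h, hC1]
      · rw [lx_basisVec_of_le (by omega), map_zero, hcn i (by omega)]
    · rw [lx_basisVec_odd, map_zero, hσ _ hj, hC1, lx_lx]
  · refine LinearMap.congr_fun (f := σ ∘ₗ (str K n).rx) (g := U.rx ∘ₗ σ)
      (str_hom_ext fun j hj => ?_) v
    simp only [LinearMap.comp_apply]
    obtain ⟨i, rfl | rfl⟩ := Nat.even_or_odd' j
    · rw [hσ _ hj, hC0]
      obtain _ | i := i
      · rw [mul_zero, rx_basisVec_zero, map_zero, h0]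
      · rw [mul_add, mul_one, rx_basisVec_even hj, hσ _ (by omega), hC1, hc i hj]
    · rw [rx_basisVec_odd, map_zero, hσ _ hj, hC1, rx_lx, hLR]
  · rw [hσ 1 hn]
    exact hC1 0

/-- Chains of functionals give homomorphisms to strings. -/
theorem exists_hom_to_str (hLR : ∀ u, U.lx (U.rx u) = 0) {n : ℕ} (hn : 1 < n)
    (β : ℕ → (U.carrier →ₗ[K] K))
    (hβ : ∀ i, 2 * i + 3 < n → ∀ u, β i (U.rx u) = β (i + 1) (U.lx u))
    (hβn : ∀ i, 2 * i + 2 = n → ∀ u, β i (U.rx u) = 0) :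
    ∃ θ : U.carrier →ₗ[K] (str K n).carrier,
      (∀ u, θ (U.lx u) = (str K n).lx (θ u)) ∧ (∀ u, θ (U.rx u) = (str K n).rx (θ u)) ∧
      ∀ u, U.rx u = 0 → β 0 (U.lx u) = 1 → θ (U.lx u) = basisVec K n 1 := by
  -- `T j` is the `j`-th coordinate of `θ`. The `β i` give the bottom coordinates; the top ones are
  -- forced by the right action, or by the left action at `j = 0`.
  let T : ℕ → (U.carrier →ₗ[K] K) := fun j =>
    if j = 0 then β 0 ∘ₗ U.lx else if Even j then β (j / 2 - 1) ∘ₗ U.rx else β (j / 2)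
  have hT0 : T 0 = β 0 ∘ₗ U.lx := rfl
  have hT2 (i : ℕ) : T (2 * i + 2) = β i ∘ₗ U.rx := by
    have h : Even (2 * i + 2) := by simp [parity_simps]
    simp [T, h]
  have hT1 (i : ℕ) : T (2 * i + 1) = β i := by
    have h : (2 * i + 1) / 2 = i := by omega
    simp [T, h]
  let θ : U.carrier →ₗ[K] (str K n).carrier :=
    ∑ j ∈ Finset.range n, (T j).smulRight (basisVec K n j)
  have hθ (j : ℕ) (u) : co n j (θ u) = if j < n then T j u else 0 := by
    simp only [θ, LinearMap.sum_apply, LinearMap.smulRight_apply, map_sum, map_smul, co_basisVec,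
      smul_eq_mul]
    by_cases hj : j < n
    · simp [hj]
    · simp [hj]
  have hl (u) : θ (U.lx u) = (str K n).lx (θ u) := by
    refine co_ext_parity (fun i => ?_) (fun i => ?_)
    · rw [hθ, co_lx_even]
      obtain _ | i := i
      · simp [hT0, lx_lx]
      · rw [mul_add, mul_one, hT2, LinearMap.comp_apply, rx_lx, hLR, map_zero, ite_self]
    · rw [hθ, co_lx_odd, hθ, hT1]
      split_ifs with h h'
      · obtain _ | i := i
        · rfl
        · rw [mul_add, mul_one, hT2, LinearMap.comp_apply, hβ i (by omega)]
      · omega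
      · rfl
  refine ⟨θ, hl, fun u => ?_, fun u hu h1 => ?_⟩
  · refine co_ext_parity (fun i => ?_) (fun i => ?_)
    · rw [hθ, co_rx_even]
      obtain _ | i := i
      · simp [hT0, hLR]
      · rw [mul_add, mul_one, hT2, LinearMap.comp_apply, rx_rx, map_zero, ite_self]
    · rw [hθ, co_rx_odd, hθ, hT1, hT2]
      split_ifs with h h' h'
      · rfl
      · exact hβn i (by omega) u
      · omega
      · rfl
  · rw [hl]
    refine co_ext_parity (fun i => ?_) (fun i => ?_)
    · rw [co_lx_even, co_basisVec, if_neg (by omega)]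
    · rw [co_lx_odd, hθ, co_basisVec]
      obtain _ | i := i
      · simp [hT0, h1, hn, Nat.zero_lt_of_lt hn]
      · rw [mul_add, mul_one, hT2, LinearMap.comp_apply, hu, map_zero]
        simp

/-- An indecomposable bimodule is a string if some vector annihilated by the right action extends to
a string of length `n`, but not to the strings that admit no homomorphism to it preserving the
leading vector. -/
theorem nonempty_iso_str (hU : Indecomposable U.tensorFunctor) (hLR : ∀ u, U.lx (U.rx u) = 0)
    {n : ℕ} (hn : 1 < n) {g : U.carrier} (hg : Extends U n g) (β : ℕ → (U.carrier →ₗ[K] K))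
    (h1 : β 0 (U.lx g) = 1)
    (hβ : ∀ i, 2 * i + 3 < n → ∀ u, β i (U.rx u) = β (i + 1) (U.lx u))
    (hβn : ∀ i, 2 * i + 2 = n → ∀ u, β i (U.rx u) = 0) :
    Nonempty (U.tensorFunctor ≅ (str K n).tensorFunctor) := by
  have hg0 : U.rx g = 0 := by
    obtain ⟨c, rfl, h, -⟩ := hg
    exact h
  obtain ⟨σ, hσl, hσr, hσ⟩ := hg.exists_hom hLR hn
  obtain ⟨θ, hθl, hθr, hθ⟩ := exists_hom_to_str hLR hn β hβ hβn
  have hθg := hθ g hg0 h1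
  -- The maps need not be mutually inverse: the composites fix `x g` and `e 1` respectively, and
  -- Fitting on both sides gives bijectivity.
  have hb1 : Function.Bijective (σ ∘ₗ θ) := by
    refine bijective_of_fixed hU _ (fun u => ?_) (fun u => ?_) (v := U.lx g) ?_ ?_
    · simp only [LinearMap.comp_apply, hθl, hσl]
    · simp only [LinearMap.comp_apply, hθr, hσr]
    · rw [LinearMap.comp_apply, hθg, hσ]
    · intro h
      rw [h, map_zero] at h1
      exact zero_ne_one h1
  have hb2 : Function.Bijective (θ ∘ₗ σ) := by
    refine bijective_of_fixed (indecomposable_str (by omega)) _ (fun u => ?_) (fun u => ?_)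
      (v := basisVec K n 1) ?_ ?_
    · simp only [LinearMap.comp_apply, hθl, hσl]
    · simp only [LinearMap.comp_apply, hθr, hσr]
    · rw [LinearMap.comp_apply, hσ, hθg]
    · intro h
      have := congrArg (co n 1) h
      simp [co_basisVec, hn] at this
  have hθb : Function.Bijective θ :=
    ⟨Function.Injective.of_comp (f := σ) hb1.1, Function.Surjective.of_comp (g := σ) hb2.2⟩
  have : IsIso (mapHom θ hθl hθr) := by
    apply isIso_of_toLin_bijective
    rw [toLin_mapHom]
    exact hθb
  exact ⟨asIso (mapHom θ hθl hθr)⟩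

/-- The last of the `j + 1` equations reads `x h_j = 0`, so unsolvability is failure at length
`2j+1`. The dual chain then has no end condition, which is what a map to a string ending at a top
vector needs. -/
theorem nonempty_iso_str_odd (hU : Indecomposable U.tensorFunctor)
    (hLR : ∀ u, U.lx (U.rx u) = 0) {j : ℕ} {g : U.carrier} (hg : Extends U (2 * j + 3) g)
    (hg' : ¬ Extends U (2 * j + 1) g) :
    Nonempty (U.tensorFunctor ≅ (str K (2 * j + 3)).tensorFunctor) := by
  obtain ⟨β, h1, hβ⟩ := exists_dual_chain U.lx U.rx (N := j + 1) (M := j + 1) (by omega) (by omega) g (by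
    rintro ⟨h, rfl, hh⟩
    refine hg' ⟨h, rfl, ?_, fun i hi => ?_, fun i hi => ?_⟩
    · obtain ⟨c, hc, h0, -⟩ := hg
      rw [← hc, h0]
    · rw [hh i (by omega), if_pos (by omega)]
    · rw [hh i (by omega), if_neg (by omega)])
  refine nonempty_iso_str hU hLR (by omega) hg β h1 (fun i hi u => ?_) (fun i hi => by omega)
  rw [hβ i (by omega), if_pos (by omega)]

/-- Here the last equation retains an unknown `h_{j+1}`, so unsolvability is failure at length
`2j+4`. Dually it gives `β_j(ux) = 0`, the end condition for a final bottom vector. -/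
theorem nonempty_iso_str_even (hU : Indecomposable U.tensorFunctor)
    (hLR : ∀ u, U.lx (U.rx u) = 0) {j : ℕ} {g : U.carrier} (hg : Extends U (2 * j + 2) g)
    (hg' : ¬ Extends U (2 * j + 4) g) :
    Nonempty (U.tensorFunctor ≅ (str K (2 * j + 2)).tensorFunctor) := by
  obtain ⟨β, h1, hβ⟩ := exists_dual_chain U.lx U.rx (N := j + 1) (M := j + 2) (by omega)
    (by omega) g (by
    rintro ⟨h, rfl, hh⟩
    refine hg' ⟨h, rfl, ?_, fun i hi => ?_, fun i hi => by omega⟩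
    · obtain ⟨c, hc, h0, -⟩ := hg
      rw [← hc, h0]
    · rw [hh i (by omega), if_pos (by omega)])
  refine nonempty_iso_str hU hLR (by omega) hg β h1 (fun i hi u => ?_) (fun i hi u => ?_)
  · rw [hβ i (by omega), if_pos (by omega)]
  · rw [hβ i (by omega), if_neg (by omega)]

end DualBimod

/-! ### Classification of indecomposables left equivalent to `W_k`. -/

namespace DualBimod

variable {K : Type u} [Field K]

open Bimodule

section Classification

variable {U Y : Bimodule K} {k : ℕ}
  {f : ℕ → (U.tensorFunctor.obj (regular K) ⟶ U.tensorFunctor.obj (regular K))}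

theorem toLin_sum {ι : Type*} (s : Finset ι)
    (h : ι → (U.tensorFunctor.obj (regular K) ⟶ U.tensorFunctor.obj (regular K))) :
    toLin (∑ i ∈ s, h i) = ∑ i ∈ s, toLin (h i) := by
  classical
  induction s using Finset.induction_on with
  | empty => simp only [Finset.sum_empty]; exact toLin_zero
  | insert a s ha ih => rw [Finset.sum_insert ha, Finset.sum_insert ha, toLin_add, ih]

theorem IsChain.rx_toLin_zero (hf : IsChain U.tensorFunctor k f) (u : U.carrier) :
    U.rx (toLin (f 0) u) = 0 := by
  have h := congrArg (fun q => toLin q u) hf.zero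
  simp only [toLin_comp, toLin_right, toLin_zero] at h
  exact h

theorem IsChain.toLin_rx (hf : IsChain U.tensorFunctor k f) (i : ℕ) (u : U.carrier) :
    toLin (f i) (U.rx u) = U.rx (toLin (f (i + 1)) u) := by
  have h := congrArg (fun q => toLin q u) (hf.shift i)
  simp only [toLin_comp, toLin_right] at h
  exact h

theorem IsChain.toLin_eq_zero (hf : IsChain U.tensorFunctor k f) {i : ℕ} (hi : k < i)
    (u : U.carrier) : toLin (f i) u = 0 := by
  rw [hf.bound i hi, toLin_zero, LinearMap.zero_apply]

theorem IsUnitChain.sum_toLin (hf : IsUnitChain U.tensorFunctor k f) (u : U.carrier) :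
    ∑ i ∈ Finset.range (k + 1), toLin (f i) u = u := by
  have h := congrArg (fun q => toLin q u) hf.sum
  simp only [toLin_sum, toLin_id, LinearMap.sum_apply] at h
  exact h

/-- In the presence of a unit chain, long strings starting at a given vector can be truncated. -/
theorem IsUnitChain.extends (hf : IsUnitChain U.tensorFunctor k f) {g : U.carrier}
    (hg : Extends U (2 * k + 4) g) : Extends U (2 * k + 1) g := by
  obtain ⟨c, rfl, h0, hc, -⟩ := hg
  -- Truncation: `h i` is the part of `c i` in chain degrees at least `i`. The shift rule gives `x
  -- h_i = h_{i+1} x`, the unit property gives `h_0 = c_0`, and no degrees remain for `h_{k+1}`.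
  let h : ℕ → U.carrier := fun i =>
    ∑ a ∈ Finset.range (k + 1), if i ≤ a then toLin (f a) (c i) else 0
  have hh0 : h 0 = c 0 := by simp [h, hf.sum_toLin]
  have hstep (i : ℕ) (hi : i ≤ k) : U.lx (h i) = U.rx (h (i + 1)) := by
    let F : ℕ → U.carrier := fun a =>
      if i + 1 ≤ a then U.rx (toLin (f a) (c (i + 1))) else 0
    have h1 : U.lx (h i) = ∑ a ∈ Finset.range (k + 1), F (a + 1) := by
      simp only [h, map_sum]
      refine Finset.sum_congr rfl fun a _ => ?_
      simp only [F, add_le_add_iff_right]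
      split_ifs with hia
      · rw [← toLin_lx, hc i (by omega), hf.toLin_rx]
      · exact map_zero _
    have h2 : U.rx (h (i + 1)) = ∑ a ∈ Finset.range (k + 1), F a := by
      simp only [h, map_sum]
      refine Finset.sum_congr rfl fun a _ => ?_
      simp only [F]
      split_ifs with hia
      · rfl
      · exact map_zero _
    have hF0 : F 0 = 0 := if_neg (by omega)
    have hFk : F (k + 1) = 0 := by
      simp only [F, hf.toLin_eq_zero (Nat.lt_succ_self k), map_zero, ite_self]
    rw [h1, h2, ← add_zero (∑ a ∈ Finset.range (k + 1), F (a + 1)), ← hF0,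
      ← Finset.sum_range_succ', Finset.sum_range_succ, hFk, add_zero]
  refine ⟨h, hh0, by rw [hh0, h0], fun i hi => hstep i (by omega), fun i hi => ?_⟩
  obtain rfl : i = k := by omega
  rw [hstep i le_rfl]
  have : h (i + 1) = 0 := Finset.sum_eq_zero fun a ha =>
    if_neg (by have := Finset.mem_range.mp ha; omega)
  rw [this, map_zero]

theorem le_of_iso_str (r : Retract (str K (2 * k + 1)).tensorFunctor
      (U.tensorFunctor ⋙ Y.tensorFunctor)) {n j : ℕ}
    (e : U.tensorFunctor ≅ (str K n).tensorFunctor) (hn : n ≤ 2 * j + 2) : k ≤ j :=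
  IsUnitChain.le_of_retract (r.trans (.ofIso (Functor.isoWhiskerRight e Y.tensorFunctor)))
    (isUnitChain_strProj hn)

/-- The simple bimodule admits a unit chain of length zero. -/
theorem not_extends_one (hU : Indecomposable U.tensorFunctor) (hk : 1 ≤ k)
    (r : Retract (str K (2 * k + 1)).tensorFunctor (U.tensorFunctor ⋙ Y.tensorFunctor))
    {g : U.carrier} (hg : ∀ a b, g ≠ U.lx a + U.rx b) :
    ¬ Extends U 1 g := by
  rintro ⟨c, rfl, h0, -, h1⟩
  have h1 := h1 0 rfl
  obtain ⟨α, hα1, hα⟩ := exists_dual_eq_one (p := LinearMap.range U.lx ⊔ LinearMap.range U.rx)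
    (v := c 0) (by
      rw [Submodule.mem_sup]
      rintro ⟨_, ⟨a, rfl⟩, _, ⟨b, rfl⟩, h⟩
      exact hg a b h.symm)
  have hl (u) : α (U.lx u) = 0 := hα _ (Submodule.mem_sup_left ⟨u, rfl⟩)
  have hr (u) : α (U.rx u) = 0 := hα _ (Submodule.mem_sup_right ⟨u, rfl⟩)
  -- A bijective map of rank one: `U` is spanned by `c 0`, so `x` acts by zero and the identity
  -- alone is a unit chain of length `0 < k`.
  have hb := bijective_of_fixed hU (α.smulRight (c 0)) (fun u => by simp [hl, h1])
    (fun u => by simp [hr, h0]) (v := c 0) (by simp [hα1]) (by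
      intro h; rw [h, map_zero] at hα1; exact zero_ne_one hα1)
  have hrx : right U.tensorFunctor = 0 := by
    apply toLin_injective
    rw [toLin_right, toLin_zero]
    refine LinearMap.ext fun u => ?_
    obtain ⟨w, rfl⟩ := hb.2 u
    simp [h0]
  have hchain : IsUnitChain U.tensorFunctor 0 fun i => if i = 0 then 𝟙 _ else 0 :=
    { zero := by rw [hrx, comp_zero]
      shift := fun i => by rw [hrx, comp_zero, zero_comp]
      bound := fun i hi => if_neg (by omega)
      sum := by simp }
  have := hchain.le_of_retract r
  omega

/-- An indecomposable bimodule `U` with a unit chain of length `k`, such that `W_k` is a direct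
summand of some `Y ∘ U`, is isomorphic to `W_k` or `S_k`. -/
theorem IsUnitChain.iso_str (hU : Indecomposable U.tensorFunctor) (hk : 1 ≤ k)
    (r : Retract (str K (2 * k + 1)).tensorFunctor (U.tensorFunctor ⋙ Y.tensorFunctor))
    (hf : IsUnitChain U.tensorFunctor k f) :
    Nonempty (U.tensorFunctor ≅ (str K (2 * k + 1)).tensorFunctor) ∨
      Nonempty (U.tensorFunctor ≅ (str K (2 * k + 2)).tensorFunctor) := by
  obtain ⟨u, hu⟩ := hf.exists_notMem_range r
  by_cases hLR : ∀ u, U.lx (U.rx u) = 0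
  swap
  · push Not at hLR
    obtain ⟨v, hv⟩ := hLR
    obtain ⟨w, hw⟩ := exists_rx_eq_of_lx_rx_ne_zero hU hv (hf.rx_toLin_zero (toLin (f 0) u))
    exact absurd hw (hu w)
  by_cases hker : ∀ g, U.rx g = 0 → ∃ a b, g = U.lx a + U.rx b
  · exfalso
    obtain ⟨a, b, hab⟩ := hker _ (hf.rx_toLin_zero u)
    obtain ⟨a', b', hab'⟩ := hker _ (hf.rx_toLin_zero a)
    -- Write `f_0 u = x a + b x` and `f_0 a = x a' + b' x`. Then `f_0² u = x (f_0 a) + (f_1 b) x`,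
    -- and the first term is zero because `x² = 0` and `xUx = 0`.
    refine hu (toLin (f 1) b) ?_
    rw [hab, map_add, toLin_lx, hf.toLin_rx, hab', map_add, lx_lx, hLR, zero_add, zero_add]
  push Not at hker
  obtain ⟨g, hg0, hg⟩ := hker
  classical
  -- Either the string can be continued, hence truncated to some odd length at most `2k+1`, or it
  -- gets stuck at an even length at most `2k+2`. Minimal lengths are taken, and `le_of_iso_str`
  -- gives the reverse bounds.
  by_cases hE : Extends U (2 * k + 4) g
  · have hex : ∃ j, Extends U (2 * j + 1) g := ⟨k, hf.extends hE⟩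
    have hj := Nat.find_spec hex
    have hjk : Nat.find hex ≤ k := Nat.find_min' hex (hf.extends hE)
    have hmin : ∀ i < Nat.find hex, ¬ Extends U (2 * i + 1) g := fun i => Nat.find_min hex
    generalize Nat.find hex = j at hj hjk hmin
    obtain _ | j := j
    · exact absurd hj (not_extends_one hU hk r hg)
    · obtain ⟨e⟩ := nonempty_iso_str_odd hU hLR hj (hmin j (by omega))
      have := le_of_iso_str r e (j := j + 1) (by omega)
      obtain rfl : k = j + 1 := by omega
      exact Or.inl ⟨e⟩
  · have hex : ∃ j, ¬ Extends U (2 * j + 4) g := ⟨k, hE⟩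
    have hj := Nat.find_spec hex
    have hjk : Nat.find hex ≤ k := Nat.find_min' hex hE
    have hmin : ∀ i < Nat.find hex, Extends U (2 * i + 4) g := fun i hi =>
      not_not.mp (Nat.find_min hex hi)
    generalize Nat.find hex = j at hj hjk hmin
    have hj' : Extends U (2 * j + 2) g := by
      obtain _ | j := j
      · exact ⟨fun i => if i = 0 then g else 0, rfl, hg0, fun i hi => by omega,
          fun i hi => by omega⟩
      · exact hmin j (by omega)
    obtain ⟨e⟩ := nonempty_iso_str_even hU hLR hj' hj
    have := le_of_iso_str r e (j := j) le_rfl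
    obtain rfl : k = j := by omega
    exact Or.inr ⟨e⟩

end Classification

/-! ### Factoring `ψ_k` through co-good 2-morphisms. -/

section CoGreat

theorem id_hom_ext {G : EndoD K} {τ τ' : 𝟭 (DMod K) ⟶ G}
    (h : (τ.app (regular K)).hom.hom (1 : DualNumber K) =
      (τ'.app (regular K)).hom.hom (1 : DualNumber K)) : τ = τ' := by
  ext X y
  have key (σ : 𝟭 (DMod K) ⟶ G) : (σ.app X).hom.hom y = (G.map (point X y)).hom.hom
      ((σ.app (regular K)).hom.hom (1 : DualNumber K)) := by
    have h1 := congrArg (fun f => f.hom.hom (1 : DualNumber K)) (σ.naturality (point X y))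
    refine .trans ?_ h1
    exact congrArg (σ.app X).hom.hom (one_smul (DualNumber K) y).symm
  exact (key τ).trans ((congrArg _ h).trans (key τ').symm)

theorem tmul_add {U V : Bimodule K} (u : U.carrier) (v v' : V.carrier) :
    tmul u (v + v') = tmul u v + tmul u v' := by
  unfold tmul
  rw [add_pure, pure_add]
  rfl

theorem tmul_smul {U V : Bimodule K} (c : K) (u : U.carrier) (v : V.carrier) :
    tmul u (c • v) = algebraMap K (DualNumber K) c • tmul u v := by
  rw [← map_point_base, map_point_tmul, algebraMap_smul]

variable {k : ℕ}

/-- If `Wψ'` is left split then `ψ_k` factors through `ψ'`. -/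
theorem exists_factor {U : Bimodule K} (ψ : 𝟭 (DMod K) ⟶ U.tensorFunctor)
    (h : IsSplitMono (Functor.whiskerRight ψ (str K (2 * k + 1)).tensorFunctor)) :
    ∃ γ : U.tensorFunctor ⟶ (str K (2 * k + 1)).tensorFunctor, strPsi K k = ψ ≫ γ := by
  obtain ⟨⟨ρ, hρ⟩⟩ := h
  let ρ' : U.tensorFunctor ⋙ (str K (2 * k + 1)).tensorFunctor ⟶
    (str K (2 * k + 1)).tensorFunctor := ρ
  -- `q u w` stands for `ρ(w ⊗ u)`, read in `W_k`.
  obtain ⟨q, hq⟩ : ∃ q : U.carrier → (str K (2 * k + 1)).carrier → (str K (2 * k + 1)).carrier,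
      ∀ u w, q u w = rid _ ((ρ'.app (regular K)).hom.hom (tmul w u)) := ⟨_, fun _ _ => rfl⟩
  have q_add (u u' w) : q (u + u') w = q u w + q u' w := by
    rw [hq, hq, hq, tmul_add, map_add]
    exact map_add _ _ _
  have q_smul (c : K) (u w) : q (c • u) w = c • q u w := by
    rw [hq, hq, tmul_smul, map_smul]
    exact (rid_smul _ _).trans (left_base _ _ _)
  have q_lx (u w) : q u ((str K _).lx w) = (str K _).lx (q u w) := by
    rw [hq, hq, ← eps_smul_tmul, map_smul]
    exact rid_smul _ _
  have q_bal (u w) : q (U.lx u) w = q u ((str K _).rx w) := by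
    rw [hq, hq, tmul_lx]
  have q_rx (u w) : q (U.rx u) w = (str K _).rx (q u w) := by
    have h1 := congrArg (fun f => f.hom.hom (tmul w u))
      (ρ'.naturality (point (regular K) (DualNumber.eps : DualNumber K)))
    rw [hq, ← right_tmul]
    refine (congrArg (rid _) h1).trans ?_
    rw [← toLin_right, hq]
    exact congrArg (fun t : (str K (2 * k + 1)).Tensor (DualNumber K) => (str K (2 * k + 1)).rid
      ((right (str K (2 * k + 1)).tensorFunctor).hom.hom t)) (pure_rid _).symm
  obtain ⟨u₀, hu₀⟩ : ∃ u₀ : U.carrier, U.pure u₀ (1 : DualNumber K) =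
      (ψ.app (regular K)).hom.hom (1 : DualNumber K) := ⟨_, pure_rid _⟩
  have q_one (w) : q u₀ w = w := by
    have h1 := congrArg (fun f => (f.app (regular K)).hom.hom
      ((str K (2 * k + 1)).pure w (1 : DualNumber K))) hρ
    have h2 : tmul w u₀ = (str K (2 * k + 1)).pure w
      ((ψ.app (regular K)).hom.hom (1 : DualNumber K)) := congrArg _ hu₀
    rw [hq, h2]
    exact (congrArg (rid _) h1).trans (rid_pure_one w)
  -- Coordinate `2i` is the diagonal coefficient of `ρ(e (2i) ⊗ u)`; coordinate `2i+1` is taken from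
  -- `ρ(e (2i+2) ⊗ u)`. The neighbour `e (2i+2)` of each bottom vector exists because `W_k` ends at
  -- a top vector.
  let φ : U.carrier →ₗ[K] (str K (2 * k + 1)).carrier :=
    { toFun := fun u => ofCo _ fun j =>
        co (2 * k + 1) j (q u (basisVec K _ (2 * ((j + 1) / 2))))
      map_add' := fun u u' => co_ext fun j => by
        rw [map_add]; simp only [co_ofCo, q_add, map_add]; split_ifs <;> ring
      map_smul' := fun c u => co_ext fun j => by
        rw [RingHom.id_apply, map_smul]
        simp only [co_ofCo, q_smul, map_smul, smul_eq_mul]; split_ifs <;> ring }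
  have hφ (u : U.carrier) (j : ℕ) : co (2 * k + 1) j (φ u) =
      co (2 * k + 1) j (q u (basisVec K _ (2 * ((j + 1) / 2)))) := by
    have h1 : φ u = ofCo _ fun j =>
        co (2 * k + 1) j (q u (basisVec K _ (2 * ((j + 1) / 2)))) := rfl
    rw [h1, co_ofCo]
    split_ifs with hj
    · rfl
    · exact (co_of_le (by omega) _).symm
  have hφ0 (u : U.carrier) (i : ℕ) : co (2 * k + 1) (2 * i) (φ u) =
      co (2 * k + 1) (2 * i) (q u (basisVec K _ (2 * i))) := by
    rw [hφ, show (2 * i + 1) / 2 = i by omega]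
  have hφ1 (u : U.carrier) (i : ℕ) : co (2 * k + 1) (2 * i + 1) (φ u) =
      co (2 * k + 1) (2 * i + 1) (q u (basisVec K _ (2 * i + 2))) := by
    rw [hφ, show 2 * ((2 * i + 1 + 1) / 2) = 2 * i + 2 by omega]
  have hφl (u : U.carrier) : φ (U.lx u) = (str K _).lx (φ u) := by
    refine co_ext_parity (fun i => ?_) (fun i => ?_)
    · rw [hφ0, co_lx_even, q_bal]
      obtain _ | i := i
      · rw [mul_zero, rx_basisVec_zero, ← (str K (2 * k + 1)).lx.map_zero, q_lx, co_zero_lx]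
      · by_cases hi : 2 * i + 2 < 2 * k + 1
        · rw [mul_add, mul_one, rx_basisVec_even hi, ← lx_basisVec_even (by omega), q_lx,
            ← Nat.mul_add_one, co_lx_even]
        · exact co_of_le (by omega) _
    · rw [hφ1, co_lx_odd, q_bal, hφ0]
      split_ifs with hi
      · rw [rx_basisVec_even (by omega), ← lx_basisVec_even hi, q_lx, co_lx_odd, if_pos hi]
      · exact co_of_le (by omega) _
  have hφr (u : U.carrier) : φ (U.rx u) = (str K _).rx (φ u) := by
    refine co_ext_parity (fun i => ?_) (fun i => ?_)
    · rw [hφ0, co_rx_even, q_rx, co_rx_even]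
    · rw [hφ1, q_rx, co_rx_odd, co_rx_odd, ← Nat.mul_add_one, hφ0]
  refine ⟨mapHom φ hφl hφr, id_hom_ext ?_⟩
  have h1 : φ u₀ = topSum K k := by
    refine co_ext_parity (fun i => ?_) (fun i => ?_)
    · rw [hφ0, q_one, co_basisVec, co_topSum]
      simp
    · rw [hφ1, q_one, co_basisVec, co_topSum]
      simp
  rw [strPsi_app, ← h1]
  exact congrArg ((mapHom φ hφl hφr).app (regular K)).hom.hom hu₀

end CoGreat

end DualBimod

/-! ### The left cell and co-greatness in `𝒟^(m)`. -/

namespace DualBimod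

variable {K : Type u} [Field K]

open Bimodule

section Membership

theorem catD_str (n : ℕ) : catD K (str K n).tensorFunctor := ⟨str K n, ⟨Iso.refl _⟩⟩

/-- Apply `retractStr` twice: the string is a summand of its composite with `W_m ∘ W_m`, and one of
the factors `W_m` is the chosen element of the cell. -/
theorem aboveJ_str {n m : ℕ} (hn : 0 < n) (h : n ≤ 2 * m + 2) :
    AboveJ K m (str K n).tensorFunctor :=
  ⟨catD_str n, indecomposable_str hn, W K m, Or.inl ⟨Iso.refl _⟩, (str K n).tensorFunctor, W K m,
    catD_str n, catD_str (2 * m + 1),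
    ⟨(retractStr h).trans ((retractStr h).map ((Functor.whiskeringLeft _ _ _).obj (W K m)))⟩⟩

theorem catDm_str {n m : ℕ} (hn : 0 < n) (h : n ≤ 2 * m + 2) : catDm K m (str K n).tensorFunctor :=
  ⟨catD_str n, 1, fun _ => (str K n).tensorFunctor, fun _ => Or.inr (aboveJ_str hn h),
    ⟨{ i := biproduct.ι (fun _ : Fin 1 => (str K n).tensorFunctor) 0
       r := biproduct.π (fun _ : Fin 1 => (str K n).tensorFunctor) 0
       retract := biproduct.ι_π_self _ _ }⟩⟩

theorem catDm_of_iso {m : ℕ} {F G : EndoD K} (e : F ≅ G) (h : catDm K m G) : catDm K m F := by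
  obtain ⟨⟨U, ⟨φ⟩⟩, n, H, hH, ⟨r⟩⟩ := h
  exact ⟨⟨U, ⟨e ≪≫ φ⟩⟩, n, H, hH, ⟨(Retract.ofIso e).trans r⟩⟩

theorem indecomposable_of_iso {C : Type*} [Category* C] [HasZeroMorphisms C]
    [HasBinaryBiproducts C] {X Y : C} (e : X ≅ Y) (h : Indecomposable Y) : Indecomposable X :=
  ⟨fun hX => h.1 (hX.of_iso e.symm), fun A B φ => h.2 A B (e.symm ≪≫ φ)⟩

theorem mem_cellWS {k : ℕ} {F : EndoD K} : F ∈ cellWS K k ↔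
    Nonempty (F ≅ (str K (2 * k + 1)).tensorFunctor) ∨
      Nonempty (F ≅ (str K (2 * k + 2)).tensorFunctor) := Iff.rfl

theorem exists_str_of_mem_cellWS {k : ℕ} {F : EndoD K} (h : F ∈ cellWS K k) :
    ∃ n, 0 < n ∧ n ≤ 2 * k + 2 ∧ Nonempty (F ≅ (str K n).tensorFunctor) := by
  rcases mem_cellWS.mp h with h | h
  · exact ⟨2 * k + 1, by omega, by omega, h⟩
  · exact ⟨2 * k + 2, by omega, le_rfl, h⟩

end Membership

variable {m k : ℕ}

theorem isLeftCell_cellWS (hk : 1 ≤ k) (hkm : k ≤ m) :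
    IsLeftCell (catDm K m) (cellWS K k) := by
  have hW : catDm K m (str K (2 * k + 1)).tensorFunctor := catDm_str (by omega) (by omega)
  refine ⟨(str K (2 * k + 1)).tensorFunctor, hW, indecomposable_str (by omega), Set.ext fun G => ?_⟩
  constructor
  · intro hG
    obtain ⟨n, hn0, hn, ⟨e⟩⟩ := exists_str_of_mem_cellWS hG
    refine ⟨catDm_of_iso e (catDm_str hn0 (by omega)),
      indecomposable_of_iso e (indecomposable_str hn0),
      ⟨(str K n).tensorFunctor, catDm_str hn0 (by omega),
        ⟨(Retract.ofIso e).trans (retractStr hn)⟩⟩, (str K (2 * k + 1)).tensorFunctor, hW, ?_⟩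
    rcases mem_cellWS.mp hG with ⟨⟨e⟩⟩ | ⟨⟨e⟩⟩
    · exact ⟨(retractStr (by omega)).trans (.ofIso (Functor.isoWhiskerRight e.symm _))⟩
    · obtain ⟨r⟩ := nonempty_retract_comp (K := K) k
      exact ⟨r.trans (.ofIso (Functor.isoWhiskerRight e.symm _))⟩
  · rintro ⟨⟨⟨U, ⟨eU⟩⟩, -⟩, hG, ⟨A, ⟨⟨V, ⟨eA⟩⟩, -⟩, ⟨rA⟩⟩, B, ⟨⟨Y, ⟨eB⟩⟩, -⟩, ⟨rB⟩⟩
    have : A.Additive := Functor.additive_of_iso eA.symm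
    have rU : Retract U.tensorFunctor ((str K (2 * k + 1)).tensorFunctor ⋙ A) :=
      (Retract.ofIso eU.symm).trans rA
    have rW : Retract (str K (2 * k + 1)).tensorFunctor (U.tensorFunctor ⋙ Y.tensorFunctor) :=
      rB.trans (.ofIso (Functor.isoWhiskerRight eU B ≪≫ Functor.isoWhiskerLeft _ eB))
    -- The block chain of `W_k` transfers to `U` because `U` is a summand of `A ∘ W_k`; the other
    -- inequality provides `rW`.
    rcases ((isUnitChain_strProj (by omega)).transfer rU).iso_str
      (indecomposable_of_iso eU.symm hG) hk rW with ⟨⟨e⟩⟩ | ⟨⟨e⟩⟩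
    · exact Or.inl ⟨eU ≪≫ e⟩
    · exact Or.inr ⟨eU ≪≫ e⟩

theorem isSplitMono_whiskerRight_strPsi {F : EndoD K} (hF : F ∈ cellWS K k) :
    IsSplitMono (Functor.whiskerRight (strPsi K k) F) := by
  obtain ⟨n, -, hn, ⟨e⟩⟩ := exists_str_of_mem_cellWS hF
  refine ⟨⟨⟨Functor.whiskerLeft _ e.hom ≫ strMulHom (n := n) (n' := 2 * k + 1) (by omega) ≫
    (Functor.leftUnitor _).inv ≫ Functor.whiskerLeft _ e.inv, ?_⟩⟩⟩
  have h1 : Functor.whiskerRight (strPsi K k) F ≫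
      Functor.whiskerLeft (str K (2 * k + 1)).tensorFunctor e.hom =
        Functor.whiskerLeft _ e.hom ≫ Functor.whiskerRight (strPsi K k) (str K n).tensorFunctor := by
    ext X x
    exact congrArg (fun f => f.hom.hom x) (e.hom.naturality ((strPsi K k).app X))
  rw [← Category.assoc, h1, Category.assoc, ← Category.assoc (Functor.whiskerRight _ _),
    whiskerRight_strPsi_strMulHom hn, Iso.hom_inv_id_assoc, ← Functor.whiskerLeft_comp,
    e.hom_inv_id]
  rfl

theorem isCoGreatVia_strPsi (hkm : k ≤ m) : IsCoGreatVia (catDm K m) (cellWS K k)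
    (str K (2 * k + 1)).tensorFunctor (strPsi K k) := by
  refine ⟨⟨catDm_str (by omega) (by omega), fun F hF => isSplitMono_whiskerRight_strPsi hF⟩, ?_⟩
  rintro H' ψ' ⟨⟨⟨U, ⟨e⟩⟩, -⟩, hψ'⟩
  -- Co-goodness is needed only at `W_k` itself.
  have h := hψ' (str K (2 * k + 1)).tensorFunctor (Or.inl ⟨Iso.refl _⟩)
  obtain ⟨γ, hγ⟩ := exists_factor (k := k) (ψ' ≫ e.hom) (by
    rw [Functor.whiskerRight_comp]
    infer_instance)
  exact ⟨e.hom ≫ γ, by rw [hγ, Category.assoc]⟩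

end DualBimod

theorem mainTheorem6 {K : Type u} [Field K] [IsAlgClosed K] [CharZero K] (m k : ℕ)
    (hk : 1 ≤ k) (hkm : k ≤ m) :
    DualBimod.IsLeftCell (DualBimod.catDm K m) (DualBimod.cellWS K k) ∧
      DualBimod.IsCoGreat (DualBimod.catDm K m) (DualBimod.cellWS K k) (DualBimod.W K k) ∧
      DualBimod.IsCoGreatVia (DualBimod.catDm K m) (DualBimod.cellWS K k) (DualBimod.W K k)
        (DualBimod.psi K k) :=
  ⟨DualBimod.isLeftCell_cellWS hk hkm, ⟨_, DualBimod.isCoGreatVia_strPsi hkm⟩,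
    DualBimod.isCoGreatVia_strPsi hkm⟩
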